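/- Identify $\partial AdS^3$ with $\mathbb{RP}^1\times\mathbb{RP}^1$, the lines $\{x\}\times\mathbb{RP}^1$ and $\mathbb{RP}^1\times\{y\}$ being the lightlike lines. A closed acausal meridian is a simple closed curve $\Gamma\subset\partial AdS^3$ which admits a parametrization whose two coordinates lift to continuous nondecreasing functions and each go once around $\mathbb{RP}^1$ (so $\Gamma$ may contain lightlike segments; graphs of orientation-preserving homeomorphisms of $\mathbb{RP}^1$ are examples). Let $\Gamma$ be a closed acausal meridian which is not the boundary of a totally geodesic plane. Let $CH(\Gamma)$ be its convex hull in the projective model of $AdS^3$, and let $\lambda_+$ and $\lambda_-$ be the measured bending laminations on the future and past boundary components of $CH(\Gamma)$, considered as measures on the set of unordered pairs of distinct points of $\Gamma$ (each leaf being identified with its pair of endpoints): the mass of a set of leaves crossed by a transverse arc is the bending along this arc, that is, the length, measured by exterior dihedral angles, of the corresponding family of spacelike support planes of $CH(\Gamma)$ (possibly infinite, if the boundary component contains lightlike faces). Then $\lambda_+$ and $\lambda_-$ weakly fill: for every complete geodesic $\gamma$, with endpoints $a,b\in\Gamma$ (that is, for all distinct $a,b\in\Gamma$ that do not lie on a common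 lightlike line of $\partial AdS^3$; if $\Gamma$ is the graph of a homeomorphism, for all distinct $a,b\in\Gamma$), $$ i(\lambda_+,\gamma)+i(\lambda_-,\gamma)>0, \qquad\text{where}\quad i(\lambda_\pm,\gamma)=\lambda_\pm\big((a,b)\times(b,a)\big) $$ and $(a,b)$, $(b,a)$ are the two open arcs of $\Gamma$ with endpoints $a$ and $b$. -/

import Mathlib

open Set MeasureTheory
open scoped ENNReal

noncomputable section

namespace AdS

/-- The vector space `ℝ^{2,2}`. -/
abbrev V : Type := EuclideanSpace ℝ (Fin 4)

/-- The bilinear form of signature `(2,2)`, `-x₀y₀ - x₁y₁ + x₂y₂ + x₃y₃`.  In the projective model,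
`AdS³ = {[x] ∈ ℝP³ | form x x < 0}`. -/
def form (x y : V) : ℝ := -(x 0 * y 0) - x 1 * y 1 + x 2 * y 2 + x 3 * y 3

/-- The boundary `∂AdS³ = {[x] ∈ ℝP³ | form x x = 0}`, identified with `ℝP¹ × ℝP¹` where
`ℝP¹ = ℝ/πℤ`; see `nullVector` for the identification. -/
abbrev Boundary : Type := AddCircle Real.pi × AddCircle Real.pi

/-- The boundary point with angular coordinates `(s, t)`. -/
def bpoint (s t : ℝ) : Boundary := ((s : AddCircle Real.pi), (t : AddCircle Real.pi))

/-- An isotropic vector representing the boundary point `(s, t)`.  In the model where `ℝ^{2,2}` is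
the space of `2 × 2` matrices with the quadratic form `-det`, this is twice the rank one matrix
`(cos s, sin s)ᵀ (cos t, sin t)`, with `x₀ = (A₀₀ + A₁₁)/2`, `x₁ = (A₁₀ - A₀₁)/2`,
`x₂ = (A₁₁ - A₀₀)/2`, `x₃ = (A₀₁ + A₁₀)/2`.  Changing `s` or `t` by `π` changes the sign.
The curves `s = const` and `t = const` are the lightlike lines of `∂AdS³`, and the conformal
Lorentzian structure is that of `ds dt`. -/
def nullVector (s t : ℝ) : V :=
  !₂[Real.cos (s - t), Real.sin (s - t), -Real.cos (s + t), Real.sin (s + t)]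

/-- Two boundary points lie on a common lightlike line of `∂AdS³`.  Distinct boundary points for
which this fails are exactly those that are joined by a complete (spacelike) geodesic of `AdS³`. -/
def OnCommonLightlikeLine (p q : Boundary) : Prop := p.1 = q.1 ∨ p.2 = q.2

/-- The boundary in `∂AdS³` of the totally geodesic plane `{[x] | form n x = 0}` (for `n ≠ 0`). -/
def planeBoundary (n : V) : Set Boundary :=
  {p | ∃ s t : ℝ, p = bpoint s t ∧ form n (nullVector s t) = 0}

/-- A (parametrized) closed acausal meridian in `∂AdS³ = ℝP¹ × ℝP¹`: a simple closed curve whose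
lift `t ↦ (left t, right t)` to the universal cover is nowhere timelike (both null coordinates are
nondecreasing; lightlike segments are allowed) and which goes once around each factor, so that it
bounds a disk in the solid torus `AdS³ ∪ ∂AdS³`.  Graphs of orientation-preserving homeomorphisms
of `ℝP¹` are the case where both coordinates are strictly increasing. -/
structure AcausalMeridian where
  left : ℝ → ℝ
  right : ℝ → ℝ
  continuous_left : Continuous left
  continuous_right : Continuous right
  monotone_left : Monotone left
  monotone_right : Monotone right
  left_add_pi : ∀ t, left (t + Real.pi) = left t + Real.pi
  right_add_pi : ∀ t, right (t + Real.pi) = right t + Real.pi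
  simple : ∀ t t' : ℝ, bpoint (left t) (right t) = bpoint (left t') (right t') →
    ∃ k : ℤ, t' = t + k * Real.pi

namespace AcausalMeridian

/-- The point of the meridian with parameter `t`; it is `π`-periodic in `t`. -/
def point (Γ : AcausalMeridian) (t : ℝ) : Boundary := bpoint (Γ.left t) (Γ.right t)

/-- The meridian as a subset of `∂AdS³`. -/
def carrier (Γ : AcausalMeridian) : Set Boundary := range Γ.point

/-- The open arc of the meridian with parameters between `t₁` and `t₂`. -/
def arc (Γ : AcausalMeridian) (t₁ t₂ : ℝ) : Set Boundary := Γ.point '' Ioo t₁ t₂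

/-- `Γ` is the boundary of a totally geodesic plane. -/
def BoundsPlane (Γ : AcausalMeridian) : Prop := ∃ n : V, n ≠ 0 ∧ Γ.carrier = planeBoundary n

/-- The (`π`-periodic) lift of the meridian to the isotropic cone of `ℝ^{2,2}`. Any two of its
vectors have nonpositive product, and all of them lie in one open half-space, which provides an
affine chart of `ℝP³` containing `Γ`. -/
def lift (Γ : AcausalMeridian) (t : ℝ) : V := nullVector (Γ.left t) (Γ.right t)

/-- The convex hull `CH(Γ)`, as a set of homogeneous coordinates: its image in `ℝP³` is the affine
convex hull of `Γ` in any affine chart containing `Γ`. -/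
def hull (Γ : AcausalMeridian) : Set V := convexHull ℝ (range Γ.lift)

/-- For a tangent vector `n` to `AdS³` at `[x]` (that is, `form x n = 0`) that is causal, this is
positive if `n` is future-directed and negative if it is past-directed: it is minus the product of
`n` with the future-directed timelike vector `(-x₁, x₀, x₃, -x₂)` at `[x]`, the value at `x` of a
nowhere vanishing timelike vector field of `AdS³` invariant under `x ↦ -x`. -/
def timeOrientation (x n : V) : ℝ := -form (!₂[-x 1, x 0, x 3, -x 2]) n

/-- The spacelike support planes of the future boundary component of `CH(Γ)`, each encoded by its
unit normal `n` pointing out of `CH(Γ)`: the plane `{form n = 0}` is spacelike (`form n n = -1`),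
touches `CH(Γ)` at a point `[x]` of `AdS³`, `CH(Γ)` is on the side opposite to `n`
(where `form n ≥ 0`), and `n` is future-directed at `[x]`. -/
def futureSupport (Γ : AcausalMeridian) : Set V :=
  {n | form n n = -1 ∧ (∀ y ∈ Γ.hull, 0 ≤ form n y) ∧
    ∃ x ∈ Γ.hull, form x x < 0 ∧ form n x = 0 ∧ 0 < timeOrientation x n}

/-- The spacelike support planes of the past boundary component of `CH(Γ)`, each encoded by its
unit normal pointing out of `CH(Γ)`, which is now past-directed. -/
def pastSupport (Γ : AcausalMeridian) : Set V :=
  {n | form n n = -1 ∧ (∀ y ∈ Γ.hull, 0 ≤ form n y) ∧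
    ∃ x ∈ Γ.hull, form x x < 0 ∧ form n x = 0 ∧ timeOrientation x n < 0}

/-- The points of `Γ` on the plane with normal `n`.  If this plane supports `CH(Γ)`, its
intersection with `CH(Γ)` is the convex hull of these points: a complete geodesic if there are two
of them, a totally geodesic ideal polygon of the pleated surface if there are more. -/
def contact (Γ : AcausalMeridian) (n : V) : Set Boundary :=
  {p | ∃ t : ℝ, p = Γ.point t ∧ form n (Γ.lift t) = 0}

end AcausalMeridian

/-- The exterior dihedral angle between two spacelike planes with unit normals `n` and `m` that
intersect (`-form n m ≥ 1`, which holds for two support planes of the same boundary component). -/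
def angle (n m : V) : ℝ := Real.arcosh (-form n m)

/-- The length measure on a family `D` of spacelike planes, relative to the dihedral angle: the
measure of `S` is the limit as `δ → 0` of the infimum of `∑ᵢ sup {angle n m | n, m ∈ Sᵢ}` over
countable coverings of `S` by sets `Sᵢ` of diameter at most `δ`.  For the planes supporting a
pleated surface along a transverse arc it is the infimum over subdivisions of the sum of the angles
between successive support planes, that is, the bending along this arc; for the support planes
along a single edge of a polyhedron it is the exterior dihedral angle at this edge. -/
def bendingLength (D : Set V) : Measure D :=
  Measure.mkMetric' fun S : Set D => ⨆ n ∈ S, ⨆ m ∈ S, ENNReal.ofReal (angle n m)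

namespace AcausalMeridian

/-- The support planes in `D` that touch `CH(Γ)` exactly along a geodesic whose pair of endpoints
belongs to `E`. -/
def planesAlong (Γ : AcausalMeridian) (D : Set V) (E : Set (Sym2 Boundary)) : Set D :=
  {n | ∃ p q : Boundary, p ≠ q ∧ Γ.contact n = {p, q} ∧ s(p, q) ∈ E}

/-- The measured bending lamination of the boundary component of `CH(Γ)` with set of support planes
`D`, as a measure on unordered pairs of distinct points of `Γ` (geodesics being identified with
their pairs of endpoints): the mass of a set of pairs is the bending measure of the
support planes along the leaves with endpoints in this set.  It is defined as an outer measure on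
all sets; it is countably additive on sets `E` with `planesAlong E` measurable. -/
def bendingLamination (Γ : AcausalMeridian) (D : Set V) : OuterMeasure (Sym2 Boundary) where
  measureOf E := bendingLength D (Γ.planesAlong D E)
  empty := by
    have h : Γ.planesAlong D ∅ = ∅ := by
      ext n; simp [planesAlong]
    rw [h]; exact measure_empty
  mono := by
    intro E F h
    apply measure_mono
    rintro n ⟨p, q, hpq, hc, hE⟩
    exact ⟨p, q, hpq, hc, h hE⟩
  iUnion_nat := by
    intro E _
    refine le_trans (measure_mono ?_) (measure_iUnion_le _)
    rintro n ⟨p, q, hpq, hc, hE⟩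
    obtain ⟨i, hi⟩ := mem_iUnion.1 hE
    exact mem_iUnion.2 ⟨i, p, q, hpq, hc, hi⟩

theorem bendingLamination_iUnion (Γ : AcausalMeridian) (D : Set V) (E : ℕ → Set (Sym2 Boundary))
    (hE : Pairwise (Function.onFun Disjoint E))
    (hm : ∀ i, MeasurableSet (Γ.planesAlong D (E i))) :
    Γ.bendingLamination D (⋃ i, E i) = ∑' i, Γ.bendingLamination D (E i) := by
  have h : Γ.planesAlong D (⋃ i, E i) = ⋃ i, Γ.planesAlong D (E i) := by
    ext n
    constructor
    · rintro ⟨p, q, hpq, hc, h⟩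
      obtain ⟨i, hi⟩ := mem_iUnion.1 h
      exact mem_iUnion.2 ⟨i, p, q, hpq, hc, hi⟩
    · intro h
      obtain ⟨i, p, q, hpq, hc, hi⟩ := mem_iUnion.1 h
      exact ⟨p, q, hpq, hc, mem_iUnion.2 ⟨i, hi⟩⟩
  change bendingLength D (Γ.planesAlong D (⋃ i, E i)) =
    ∑' i, bendingLength D (Γ.planesAlong D (E i))
  rw [h]
  refine measure_iUnion ?_ hm
  intro i j hij
  refine disjoint_left.2 ?_
  rintro n ⟨p, q, hpq, hc, h₁⟩ ⟨p', q', hpq', hc', h₂⟩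
  have hs : s(p, q) = s(p', q') := by
    rcases pair_eq_pair_iff.1 (hc.symm.trans hc') with ⟨rfl, rfl⟩ | ⟨rfl, rfl⟩
    · rfl
    · exact Sym2.eq_swap
  exact disjoint_left.1 (hE hij) h₁ (hs ▸ h₂)

/-- The measured bending lamination `λ₊` of the future boundary component of `CH(Γ)`. -/
def futureBending (Γ : AcausalMeridian) : OuterMeasure (Sym2 Boundary) :=
  Γ.bendingLamination Γ.futureSupport

/-- The measured bending lamination `λ₋` of the past boundary component of `CH(Γ)`. -/
def pastBending (Γ : AcausalMeridian) : OuterMeasure (Sym2 Boundary) :=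
  Γ.bendingLamination Γ.pastSupport

/-- The geodesics crossing the geodesic `γ` with endpoints `a = Γ.point t₁` and `b = Γ.point t₂`
(`t₁ < t₂ < t₁ + π`): those with one endpoint in each of the arcs `(a,b)` and `(b,a)` of `Γ`. -/
def crossing (Γ : AcausalMeridian) (t₁ t₂ : ℝ) : Set (Sym2 Boundary) :=
  {e | ∃ x ∈ Γ.arc t₁ t₂, ∃ y ∈ Γ.arc t₂ (t₁ + Real.pi), e = s(x, y)}

/-- The intersection number `i(μ, γ)` of a lamination `μ` with the complete geodesic `γ` with
endpoints `Γ.point t₁` and `Γ.point t₂`. -/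
def intersectionNumber (Γ : AcausalMeridian) (μ : OuterMeasure (Sym2 Boundary)) (t₁ t₂ : ℝ) :
    ℝ≥0∞ :=
  μ (Γ.crossing t₁ t₂)

end AcausalMeridian

end AdS

end

/-!
Let `a`, `b` be the endpoints of the geodesic `γ`, and let `e`, `f` be the two other intersection
points of the lightlike lines through `a` and `b`.  The isotropic vectors of these four points form
a basis of `ℝ^{2,2}`, and on `Γ` the products with `e` and `f` are nonnegative on one of the arcs
cut out by `a` and `b` and nonpositive on the other.  A normal `n` with prescribed values at `a` and
`b` depends on two coefficients, and being nonnegative on `Γ` is a family of linear constraints on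
them.  If `Γ` does not lie on a plane, a suitable linear function of the coefficients is bounded on
the feasible set in one of the two directions (future or past), and an extremal normal touches `Γ`
in both arcs (`exists_saturated`); it is then automatically timelike.  So for every `κ > 0` there
is a spacelike support plane crossing `γ` with `form n a / form n b = κ`
(`exists_mem_crossingSupport`), and each such plane supports the future or the past boundary
component, because the time orientation cannot vanish at a contact point.

It remains to see that the bending measure detects these planes.  Suppose that `n`, `m` are crossing
support planes close to a plane `n₀` with exactly two contact points `p`, `q`.  The difference
`n - m` is nonpositive at the contact points of `n` and nonnegative at those of `m`, and both are
close to `p` and `q`.  Hence a limit direction of such differences is orthogonal to `p`, `q` and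
`n₀`, so it is spacelike (`form_self_pos_of_orthogonal`).  By compactness the Lorentzian length of
`n - m`, and with it the angle between the planes, is bounded below by a multiple of the Euclidean
length (`exists_norm_sq_le_form`), and the ratio above is locally Lipschitz with respect to the
angle.  If both intersection numbers were zero, the ratios of planes with two contact points would
form a Lebesgue null set (`volume_image_geodesicSupport_eq_zero`).  Planes with three contact points
separated by fixed intervals are isolated by the same limiting argument, so they
contribute a null set too.  This contradicts the fact that all positive numbers are ratios.
-/

namespace AdS

/-! ### The quadratic form of signature `(2,2)` -/

lemma form_comm (x y : V) : form x y = form y x := by simp only [form]; ring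

lemma form_add_left (x y z : V) : form (x + y) z = form x z + form y z := by
  simp only [form, PiLp.add_apply]; ring

lemma form_sub_left (x y z : V) : form (x - y) z = form x z - form y z := by
  simp only [form, PiLp.sub_apply]; ring

lemma form_smul_left (c : ℝ) (x y : V) : form (c • x) y = c * form x y := by
  simp only [form, PiLp.smul_apply, smul_eq_mul]; ring

lemma form_add_right (x y z : V) : form x (y + z) = form x y + form x z := by
  simp only [form, PiLp.add_apply]; ring

lemma form_sub_right (x y z : V) : form x (y - z) = form x y - form x z := by
  simp only [form, PiLp.sub_apply]; ring

lemma form_smul_right (c : ℝ) (x y : V) : form x (c • y) = c * form x y := by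
  simp only [form, PiLp.smul_apply, smul_eq_mul]; ring

lemma continuous_form : Continuous fun z : V × V => form z.1 z.2 := by
  unfold form; fun_prop

lemma tendsto_form {ι : Type*} {l : Filter ι} {x y : ι → V} {a b : V}
    (hx : Filter.Tendsto x l (nhds a)) (hy : Filter.Tendsto y l (nhds b)) :
    Filter.Tendsto (fun i => form (x i) (y i)) l (nhds (form a b)) := by
  have h : Filter.Tendsto (fun z : V × V => form z.1 z.2) (nhds (a, b)) (nhds (form a b)) :=
    continuous_form.tendsto' _ _ rfl
  have h' := h.comp (hx.prodMk_nhds hy)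
  exact h'

lemma contDiff_form_left (y : V) : ContDiff ℝ 1 fun x : V => form x y := by
  unfold form; fun_prop

lemma ext_coords {u v : V} (h0 : u 0 = v 0) (h1 : u 1 = v 1) (h2 : u 2 = v 2) (h3 : u 3 = v 3) :
    u = v := by
  ext i; fin_cases i <;> assumption

/-- Two orthogonal timelike vectors span a maximal negative definite subspace, so the form is
positive definite on their orthogonal complement. -/
lemma form_self_pos_of_orthogonal {n x u : V} (hn : form n n < 0) (hx : form x x < 0)
    (hnx : form n x = 0) (hun : form u n = 0) (hux : form u x = 0) (hu : u ≠ 0) :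
    0 < form u u := by
  by_contra! hneg
  -- a vector of `span {n, x}` is timelike unless both coefficients vanish
  have key : ∀ A B : ℝ, form (A • n + B • x) (A • n + B • x)
      = A ^ 2 * form n n + B ^ 2 * form x x := by
    intro A B
    simp only [form_add_left, form_add_right, form_smul_left, form_smul_right, hnx,
      form_comm x n]
    ring
  have small : ∀ A B : ℝ, 0 ≤ A ^ 2 * form n n + B ^ 2 * form x x → A = 0 ∧ B = 0 := by
    intro A B h
    have h1 := sq_nonneg A
    have h2 := sq_nonneg B
    constructor
    · by_contra hA
      have : 0 < A ^ 2 := by positivity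
      nlinarith
    · by_contra hB
      have : 0 < B ^ 2 := by positivity
      nlinarith
  -- the negative parts of `n` and `x` are linearly independent
  have hΔ : n 0 * x 1 - n 1 * x 0 ≠ 0 := by
    intro hΔ
    have h0 := small (x 0) (-n 0) (by
      rw [← key]
      have e0 : (x 0 • n + (-n 0) • x : V) 0 = 0 := by
        simp only [PiLp.add_apply, PiLp.smul_apply, smul_eq_mul]; ring
      have e1 : (x 0 • n + (-n 0) • x : V) 1 = 0 := by
        simp only [PiLp.add_apply, PiLp.smul_apply, smul_eq_mul]; linarith
      rw [form, e0, e1]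
      nlinarith [mul_self_nonneg ((x 0 • n + (-n 0) • x : V) 2),
        mul_self_nonneg ((x 0 • n + (-n 0) • x : V) 3)])
    have h1 := small (x 1) (-n 1) (by
      rw [← key]
      have e0 : (x 1 • n + (-n 1) • x : V) 0 = 0 := by
        simp only [PiLp.add_apply, PiLp.smul_apply, smul_eq_mul]; linarith
      have e1 : (x 1 • n + (-n 1) • x : V) 1 = 0 := by
        simp only [PiLp.add_apply, PiLp.smul_apply, smul_eq_mul]; ring
      rw [form, e0, e1]
      nlinarith [mul_self_nonneg ((x 1 • n + (-n 1) • x : V) 2),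
        mul_self_nonneg ((x 1 • n + (-n 1) • x : V) 3)])
    have a0 : n 0 = 0 := by linarith [h0.2]
    have a1 : n 1 = 0 := by linarith [h1.2]
    rw [form, a0, a1] at hn
    nlinarith [mul_self_nonneg (n 2), mul_self_nonneg (n 3)]
  set Δ := n 0 * x 1 - n 1 * x 0 with hΔdef
  set A := u 0 * x 1 - u 1 * x 0 with hA
  set B := n 0 * u 1 - n 1 * u 0 with hB
  -- `w` is the vector of `span {n, x}` with the same negative part as `Δ • u`
  set w : V := A • n + B • x with hw
  have w0 : w 0 = Δ * u 0 := by
    simp only [hw, PiLp.add_apply, PiLp.smul_apply, smul_eq_mul, hA, hB, hΔdef]; ring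
  have w1 : w 1 = Δ * u 1 := by
    simp only [hw, PiLp.add_apply, PiLp.smul_apply, smul_eq_mul, hA, hB, hΔdef]; ring
  have huw : form u w = 0 := by
    simp only [hw, form_add_right, form_smul_right, hun, hux]; ring
  have hww : form w w = A ^ 2 * form n n + B ^ 2 * form x x := key A B
  have hww0 : 0 ≤ form w w := by
    have e : form (Δ • u - w) (Δ • u - w) = Δ ^ 2 * form u u + form w w := by
      simp only [form_sub_left, form_sub_right, form_smul_left, form_smul_right, huw,
        form_comm w u]
      ring
    have e' : 0 ≤ form (Δ • u - w) (Δ • u - w) := by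
      rw [form]
      have z0 : (Δ • u - w) 0 = 0 := by
        simp only [PiLp.sub_apply, PiLp.smul_apply, smul_eq_mul, w0]; ring
      have z1 : (Δ • u - w) 1 = 0 := by
        simp only [PiLp.sub_apply, PiLp.smul_apply, smul_eq_mul, w1]; ring
      rw [z0, z1]
      nlinarith [mul_self_nonneg ((Δ • u - w) 2), mul_self_nonneg ((Δ • u - w) 3)]
    nlinarith [sq_nonneg Δ]
  obtain ⟨A0, B0⟩ := small A B (hww ▸ hww0)
  have hw0 : w = 0 := by rw [hw, A0, B0]; simp
  have u0 : u 0 = 0 := by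
    have : Δ * u 0 = 0 := by rw [← w0, hw0]; rfl
    exact (mul_eq_zero.1 this).resolve_left hΔ
  have u1 : u 1 = 0 := by
    have : Δ * u 1 = 0 := by rw [← w1, hw0]; rfl
    exact (mul_eq_zero.1 this).resolve_left hΔ
  rw [form, u0, u1] at hneg
  have s2 := mul_self_nonneg (u 2)
  have s3 := mul_self_nonneg (u 3)
  have u2 : u 2 = 0 := mul_self_eq_zero.1 (by linarith)
  have u3 : u 3 = 0 := mul_self_eq_zero.1 (by linarith)
  exact hu (ext_coords u0 u1 u2 u3)

/-- The timelike vector field `x ↦ (-x₁, x₀, x₃, -x₂)` defining the time orientation. -/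
def timeField (x : V) : V := !₂[-x 1, x 0, x 3, -x 2]

lemma timeOrientation_eq (x n : V) : AcausalMeridian.timeOrientation x n = -form (timeField x) n := rfl

lemma form_timeField_self (x : V) : form (timeField x) (timeField x) = form x x := by
  simp [form, timeField]; ring

lemma form_timeField_right (x : V) : form x (timeField x) = 0 := by
  simp [form, timeField]; ring

/-- A timelike normal orthogonal to `x` is not orthogonal to the time field at `x`, since `x` and
the time field span a maximal negative definite subspace. -/
lemma timeOrientation_ne_zero {x n : V} (hx : form x x < 0) (hn : form n n < 0)
    (hnx : form n x = 0) : AcausalMeridian.timeOrientation x n ≠ 0 := by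
  intro h
  have hn0 : n ≠ 0 := by rintro rfl; simp [form] at hn
  have := form_self_pos_of_orthogonal hx (by rwa [form_timeField_self]) (form_timeField_right x)
    hnx (by rw [form_comm]; rw [timeOrientation_eq] at h; linarith) hn0
  linarith

/-- The orthogonal complement of a timelike vector has signature `(2,1)`, so it contains no
isotropic plane: two orthogonal isotropic vectors in it are proportional. -/
lemma exists_smul_of_isotropic {n v w : V} (hn : form n n < 0) (hv : form v v = 0)
    (hw : form w w = 0) (hnv : form n v = 0) (hnw : form n w = 0) (hvw : form v w = 0)
    (hw0 : w ≠ 0) : ∃ c : ℝ, v = c • w := by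
  have hJ : form (timeField n) (timeField n) < 0 := by rwa [form_timeField_self]
  set c := form w (timeField n) with hc
  set d := form v (timeField n) with hd
  have hc0 : c ≠ 0 := by
    intro h
    have := form_self_pos_of_orthogonal hn hJ (form_timeField_right n)
      (by rwa [form_comm]) h hw0
    linarith
  have hu : c • v - d • w = 0 := by
    by_contra hu
    have := form_self_pos_of_orthogonal hn hJ (form_timeField_right n)
      (u := c • v - d • w)
      (by rw [form_sub_left, form_smul_left, form_smul_left, form_comm v, form_comm w, hnv, hnw]
          ring)
      (by rw [form_sub_left, form_smul_left, form_smul_left, ← hc, ← hd]; ring) hu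
    simp only [form_sub_left, form_sub_right, form_smul_left, form_smul_right, hv, hw, hvw,
      form_comm w v] at this
    linarith
  refine ⟨c⁻¹ * d, ?_⟩
  rw [mul_smul, ← sub_eq_zero.1 hu, smul_smul, inv_mul_cancel₀ hc0, one_smul]

/-- Three isotropic vectors with nonzero products, together with a timelike vector orthogonal
to them, span the whole space. -/
lemma eq_zero_of_form_eq_zero {n p q r d : V} (hn : form n n < 0)
    (hp : form p p = 0) (hq : form q q = 0) (hr : form r r = 0)
    (hnp : form n p = 0) (hnq : form n q = 0) (hnr : form n r = 0)
    (hpq : form p q ≠ 0) (hpr : form p r ≠ 0) (hqr : form q r ≠ 0)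
    (hdn : form d n = 0) (hdp : form d p = 0) (hdq : form d q = 0) (hdr : form d r = 0) :
    d = 0 := by
  have hli : LinearIndependent ℝ ![n, p, q, r] := by
    rw [Fintype.linearIndependent_iff]
    intro g hg
    simp only [Fin.sum_univ_four, Matrix.cons_val_zero, Matrix.cons_val_one,
      Matrix.cons_val] at hg
    have pair : ∀ y : V, g 0 * form n y + g 1 * form p y + g 2 * form q y + g 3 * form r y = 0 := by
      intro y
      have := congrArg (fun z => form z y) hg
      simpa only [form_add_left, form_smul_left, show form 0 y = 0 by simp [form]] using this
    have e0 := pair n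
    have e1 := pair p
    have e2 := pair q
    have e3 := pair r
    rw [form_comm p n, form_comm q n, form_comm r n, hnp, hnq, hnr] at e0
    rw [hnp, hp, form_comm q p, form_comm r p] at e1
    rw [hnq, hq, form_comm r q] at e2
    rw [hnr, hr] at e3
    have g0 : g 0 = 0 := by
      have : g 0 * form n n = 0 := by linarith
      exact (mul_eq_zero.1 this).resolve_right hn.ne
    -- elimination in the nonsingular system with the Gram matrix of `p`, `q`, `r`
    have g1 : g 1 = 0 := by
      have : g 1 * (2 * (form p q * form p r)) = 0 := by
        linear_combination form p r * e2 + form p q * e3 - form q r * e1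
      exact (mul_eq_zero.1 this).resolve_right (by positivity)
    have g3 : g 3 = 0 := by
      rw [g1] at e2
      have : g 3 * form q r = 0 := by linarith
      exact (mul_eq_zero.1 this).resolve_right hqr
    have g2 : g 2 = 0 := by
      rw [g1] at e3
      have : g 2 * form q r = 0 := by linarith
      exact (mul_eq_zero.1 this).resolve_right hqr
    intro i; fin_cases i <;> assumption
  have hspan := hli.span_eq_top_of_card_eq_finrank (by simp)
  have all : ∀ y : V, form d y = 0 := by
    intro y
    have hy : y ∈ Submodule.span ℝ (range ![n, p, q, r]) := by rw [hspan]; trivial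
    induction hy using Submodule.span_induction with
    | mem x hx =>
      obtain ⟨i, rfl⟩ := hx
      fin_cases i <;> assumption
    | zero => simp [form]
    | add x y _ _ hx hy => rw [form_add_right, hx, hy, add_zero]
    | smul a x _ hx => rw [form_smul_right, hx, mul_zero]
  have h0 := all !₂[1, 0, 0, 0]
  have h1 := all !₂[0, 1, 0, 0]
  have h2 := all !₂[0, 0, 1, 0]
  have h3 := all !₂[0, 0, 0, 1]
  simp [form] at h0 h1 h2 h3
  exact ext_coords h0 h1 h2 h3

/-! ### Isotropic vectors and boundary points -/

lemma form_nullVector (s t s' t' : ℝ) :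
    form (nullVector s t) (nullVector s' t') = -2 * Real.sin (s - s') * Real.sin (t - t') := by
  simp [form, nullVector, Real.sin_sub, Real.cos_sub, Real.sin_add, Real.cos_add]
  ring

lemma form_nullVector_self (s t : ℝ) : form (nullVector s t) (nullVector s t) = 0 := by
  simp [form_nullVector]

lemma nullVector_ne_zero (s t : ℝ) : nullVector s t ≠ 0 := by
  intro h
  have := form_nullVector s t (s - Real.pi / 2) (t - Real.pi / 2)
  rw [h] at this
  simp [form] at this

lemma nullVector_add_pi (s t : ℝ) : nullVector (s + Real.pi) (t + Real.pi) = nullVector s t := by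
  have h1 : s + Real.pi - (t + Real.pi) = s - t := by ring
  have h2 : s + Real.pi + (t + Real.pi) = s + t + 2 * Real.pi := by ring
  simp [nullVector, h1, h2]

lemma coe_eq_coe_of_sin_eq_zero {x y : ℝ} (h : Real.sin (x - y) = 0) :
    (x : AddCircle Real.pi) = (y : AddCircle Real.pi) := by
  obtain ⟨k, hk⟩ := Real.sin_eq_zero_iff.1 h
  refine QuotientAddGroup.eq_iff_sub_mem.2 ?_
  rw [← hk]
  exact AddSubgroup.mem_zmultiples_iff.2 ⟨k, by simp⟩

lemma bpoint_eq_of_sin_eq_zero {s t s' t' : ℝ} (h : Real.sin (s - s') = 0)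
    (h' : Real.sin (t - t') = 0) : bpoint s t = bpoint s' t' :=
  Prod.ext (coe_eq_coe_of_sin_eq_zero h) (coe_eq_coe_of_sin_eq_zero h')

lemma bpoint_eq_of_nullVector_smul {s t s' t' c : ℝ} (h : nullVector s t = c • nullVector s' t') :
    bpoint s t = bpoint s' t' := by
  have hc : c ≠ 0 := by
    rintro rfl
    exact nullVector_ne_zero s t (by simpa using h)
  have key : ∀ σ τ : ℝ, Real.sin (s - σ) * Real.sin (t - τ)
      = c * (Real.sin (s' - σ) * Real.sin (t' - τ)) := by
    intro σ τ
    have := form_nullVector s t σ τ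
    rw [h, form_smul_left, form_nullVector] at this
    linarith
  have h1 := key s (t' - Real.pi / 2)
  have h2 := key (s' - Real.pi / 2) t
  simp [hc] at h1 h2
  refine bpoint_eq_of_sin_eq_zero ?_ ?_
  · rw [← neg_sub, Real.sin_neg, h1, neg_zero]
  · rw [← neg_sub, Real.sin_neg, h2, neg_zero]

/-- Distinct boundary points of a spacelike plane do not lie on a common lightlike line. -/
lemma form_nullVector_ne_zero_of_bpoint_ne {n : V} (hn : form n n < 0) {s t s' t' : ℝ}
    (h : form n (nullVector s t) = 0) (h' : form n (nullVector s' t') = 0)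
    (hne : bpoint s t ≠ bpoint s' t') : form (nullVector s t) (nullVector s' t') ≠ 0 := by
  intro h0
  obtain ⟨c, hc⟩ := exists_smul_of_isotropic hn (form_nullVector_self s t)
    (form_nullVector_self s' t') h h' h0 (nullVector_ne_zero s' t')
  exact hne (bpoint_eq_of_nullVector_smul hc)

/-! ### Acausal meridians -/

lemma surjective_of_add_period {g : ℝ → ℝ} (hg : Continuous g) {p c : ℝ} (hc : 0 < c)
    (h : ∀ u, g (u + p) = g u + c) : Function.Surjective g := by
  have hk : ∀ (k : ℕ) (u : ℝ), g (u + k * p) = g u + k * c := by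
    intro k
    induction k with
    | zero => simp
    | succ k ih =>
      intro u
      have : u + ((k + 1 : ℕ) : ℝ) * p = (u + k * p) + p := by push_cast; ring
      rw [this, h, ih]; push_cast; ring
  intro y
  refine mem_range_of_exists_le_of_exists_ge hg ?_ ?_
  · obtain ⟨k, hk'⟩ := exists_nat_ge ((g 0 - y) / c)
    refine ⟨-(k * p), ?_⟩
    have := hk k (-(k * p))
    rw [neg_add_cancel] at this
    rw [div_le_iff₀ hc] at hk'
    linarith
  · obtain ⟨k, hk'⟩ := exists_nat_ge ((y - g 0) / c)
    refine ⟨0 + k * p, ?_⟩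
    rw [hk]
    rw [div_le_iff₀ hc] at hk'
    linarith

namespace AcausalMeridian

variable (Γ : AcausalMeridian)

lemma lift_add_pi (u : ℝ) : Γ.lift (u + Real.pi) = Γ.lift u := by
  simp only [lift, left_add_pi, right_add_pi, nullVector_add_pi]

lemma continuous_lift : Continuous Γ.lift := by
  have hl := Γ.continuous_left
  have hr := Γ.continuous_right
  unfold lift nullVector
  fun_prop

lemma form_lift_self (u : ℝ) : form (Γ.lift u) (Γ.lift u) = 0 := form_nullVector_self _ _

lemma left_sub_mem {u v : ℝ} (h : u ≤ v) (h' : v ≤ u + Real.pi) :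
    Γ.left v - Γ.left u ∈ Icc 0 Real.pi := by
  have h1 := Γ.monotone_left h
  have h2 := Γ.monotone_left h'
  rw [left_add_pi] at h2
  constructor <;> linarith

lemma right_sub_mem {u v : ℝ} (h : u ≤ v) (h' : v ≤ u + Real.pi) :
    Γ.right v - Γ.right u ∈ Icc 0 Real.pi := by
  have h1 := Γ.monotone_right h
  have h2 := Γ.monotone_right h'
  rw [right_add_pi] at h2
  constructor <;> linarith

lemma form_lift_nonpos {u v : ℝ} (h : u ≤ v) (h' : v ≤ u + Real.pi) :
    form (Γ.lift v) (Γ.lift u) ≤ 0 := by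
  rw [lift, lift, form_nullVector]
  have h1 := Real.sin_nonneg_of_mem_Icc (Γ.left_sub_mem h h')
  have h2 := Real.sin_nonneg_of_mem_Icc (Γ.right_sub_mem h h')
  nlinarith [mul_nonneg h1 h2]

lemma point_ne_of_lt {u v : ℝ} (h : u < v) (h' : v < u + Real.pi) : Γ.point u ≠ Γ.point v := by
  intro he
  obtain ⟨k, hk⟩ := Γ.simple u v he
  have hpi := Real.pi_pos
  have k0 : (0 : ℝ) < k := by
    by_contra! hk0
    nlinarith
  have k1 : (k : ℝ) < 1 := by
    by_contra! hk1
    nlinarith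
  have k0' : 0 < k := by exact_mod_cast k0
  have k1' : k < 1 := by exact_mod_cast k1
  omega

lemma exists_shift_mem_Ico (u t : ℝ) :
    ∃ v ∈ Ico t (t + Real.pi), Γ.lift v = Γ.lift u ∧ Γ.point v = Γ.point u := by
  have hper : Function.Periodic (fun u => (Γ.lift u, Γ.point u)) Real.pi := by
    intro u
    simp only [lift_add_pi, point, left_add_pi, right_add_pi, Prod.mk.injEq, true_and]
    exact bpoint_eq_of_sin_eq_zero (by simp) (by simp)
  obtain ⟨v, hv, he⟩ := hper.exists_mem_Ico Real.pi_pos u t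
  have he' := Prod.ext_iff.1 he
  exact ⟨v, hv, he'.1.symm, he'.2.symm⟩

/-- A meridian is not contained in the union of the two lightlike lines through a boundary
point: it would have to pass twice through this point. -/
lemma exists_sin_mul_sin_ne_zero (s t : ℝ) :
    ∃ u, Real.sin (Γ.left u - s) * Real.sin (Γ.right u - t) ≠ 0 := by
  by_contra! hall
  have hpi := Real.pi_pos
  have hsurj : Function.Surjective fun u => Γ.left u + Γ.right u := by
    refine surjective_of_add_period (p := Real.pi) (c := 2 * Real.pi)
      (Γ.continuous_left.add Γ.continuous_right) (by positivity) ?_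
    intro u
    simp only [left_add_pi, right_add_pi]; ring
  have hmono : Monotone fun u => Γ.left u + Γ.right u := Γ.monotone_left.add Γ.monotone_right
  obtain ⟨u₀, h₀⟩ := hsurj (s + t)
  obtain ⟨u₁, h₁⟩ := hsurj (s + t + Real.pi)
  simp only at h₀ h₁
  have e₀ : Γ.point u₀ = bpoint s t := by
    have e : Γ.right u₀ - t = -(Γ.left u₀ - s) := by linarith
    have := hall u₀
    rw [e, Real.sin_neg] at this
    have hs : Real.sin (Γ.left u₀ - s) = 0 := by
      rcases mul_eq_zero.1 this with h | h <;> linarith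
    exact bpoint_eq_of_sin_eq_zero hs (by rw [e, Real.sin_neg, hs, neg_zero])
  have e₁ : Γ.point u₁ = bpoint s t := by
    have e : Γ.right u₁ - t = Real.pi - (Γ.left u₁ - s) := by linarith
    have := hall u₁
    rw [e, Real.sin_pi_sub] at this
    have hs : Real.sin (Γ.left u₁ - s) = 0 := mul_self_eq_zero.1 this
    exact bpoint_eq_of_sin_eq_zero hs (by rw [e, Real.sin_pi_sub, hs])
  have hu : u₀ < u₁ := by
    by_contra! hle
    have := hmono hle
    simp only at this
    linarith
  refine Γ.point_ne_of_lt hu ?_ (e₀.trans e₁.symm)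
  by_contra! hle
  have := hmono hle
  simp only [left_add_pi, right_add_pi] at this
  linarith

/-- A meridian contained in the boundary of a spacelike plane is equal to it. -/
lemma boundsPlane_of_forall {n : V} (hn : form n n < 0) (h : ∀ u, form n (Γ.lift u) = 0) :
    Γ.BoundsPlane := by
  refine ⟨n, ?_, Subset.antisymm ?_ ?_⟩
  · rintro rfl; simp [form] at hn
  · rintro _ ⟨u, rfl⟩
    exact ⟨Γ.left u, Γ.right u, rfl, h u⟩
  · rintro _ ⟨s, t, rfl, hst⟩
    obtain ⟨u, rfl⟩ := surjective_of_add_period Γ.continuous_left Real.pi_pos Γ.left_add_pi s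
    refine ⟨u, ?_⟩
    by_contra hne
    exact form_nullVector_ne_zero_of_bpoint_ne hn (h u) hst hne (by simp [form_nullVector])

lemma form_lift_neg_of_contact {n : V} (hn : form n n < 0) {u v : ℝ} (huv : u < v)
    (hvu : v < u + Real.pi) (hu : form n (Γ.lift u) = 0) (hv : form n (Γ.lift v) = 0) :
    form (Γ.lift u) (Γ.lift v) < 0 := by
  refine lt_of_le_of_ne ?_ (form_nullVector_ne_zero_of_bpoint_ne hn hu hv
    (Γ.point_ne_of_lt huv hvu))
  rw [form_comm]
  exact Γ.form_lift_nonpos huv.le hvu.le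

end AcausalMeridian

/-! ### An extremal problem in the plane -/

/-- Maximizing `α - β` under the constraints `0 ≤ G u + α P u + β Q u` gives a pair for which
constraints of both families `K` and `L` are saturated: with slack on `K` (where `0 ≤ Q`) one can
decrease `β`, with slack on `L` (where `P ≤ 0`) one can increase `α`. -/
lemma exists_saturated_of_lt {K L : Set ℝ} (hK : IsCompact K) (hL : IsCompact L)
    {G P Q : ℝ → ℝ} (hG : Continuous G) (hP : Continuous P) (hQ : Continuous Q)
    (hGK : ∀ u ∈ K, 0 ≤ G u) (hGL : ∀ u ∈ L, 0 ≤ G u)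
    (hPK : ∀ u ∈ K, 0 ≤ P u) (hQK : ∀ u ∈ K, 0 ≤ Q u)
    (hPL : ∀ u ∈ L, P u ≤ 0) (hQL : ∀ u ∈ L, Q u ≤ 0)
    {k l : ℝ} (hk : k ∈ K) (hl : l ∈ L) (hlt : P l * Q k < P k * Q l) :
    ∃ α β : ℝ, (∀ u ∈ K ∪ L, 0 ≤ G u + α * P u + β * Q u) ∧
      (∃ u ∈ K, G u + α * P u + β * Q u = 0) ∧ ∃ u ∈ L, G u + α * P u + β * Q u = 0 := by
  set A : Set (ℝ × ℝ) :=
    {z | 0 ≤ z.1 - z.2 ∧ ∀ u ∈ K ∪ L, 0 ≤ G u + z.1 * P u + z.2 * Q u} with hA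
  have hAne : A.Nonempty := by
    refine ⟨(0, 0), by simp, fun u hu => ?_⟩
    rcases hu with hu | hu
    · simpa using hGK u hu
    · simpa using hGL u hu
  have hAcl : IsClosed A := by
    have : A = {z : ℝ × ℝ | 0 ≤ z.1 - z.2} ∩
        ⋂ u ∈ K ∪ L, {z : ℝ × ℝ | 0 ≤ G u + z.1 * P u + z.2 * Q u} := by
      ext z; simp [hA]
    rw [this]
    refine (isClosed_le (by fun_prop) (by fun_prop)).inter
      (isClosed_biInter fun u _ => isClosed_le (by fun_prop) (by fun_prop))
  -- a suitable combination of the constraints at `k` and `l` bounds `α - β`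
  have hPk := hPK k hk
  have hQk := hQK k hk
  have hPl := hPL l hl
  have hQl := hQL l hl
  have hGk := hGK k hk
  have hGl := hGL l hl
  have hsk : 0 < P k + Q k := by
    by_contra! h
    have e1 : P k = 0 := by linarith
    have e2 : Q k = 0 := by linarith
    rw [e1, e2] at hlt; simp at hlt
  have hsl : 0 < -P l - Q l := by
    by_contra! h
    have e1 : P l = 0 := by linarith
    have e2 : Q l = 0 := by linarith
    rw [e1, e2] at hlt; simp at hlt
  set Δ := P k * Q l - P l * Q k with hΔ
  have hΔ0 : 0 < Δ := by linarith
  set M := (G k * (-P l - Q l) + G l * (P k + Q k)) / Δ with hM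
  have hdiff : ∀ z ∈ A, z.1 - z.2 ≤ M := by
    intro z hz
    have c1 := mul_nonneg (hz.2 k (Or.inl hk)) hsl.le
    have c2 := mul_nonneg (hz.2 l (Or.inr hl)) hsk.le
    rw [hM, le_div_iff₀ hΔ0, hΔ]
    linarith
  have hlow : ∀ z ∈ A, -G k / (P k + Q k) ≤ z.1 := by
    intro z hz
    have c1 := hz.2 k (Or.inl hk)
    have c2 := mul_nonneg hz.1 hQk
    rw [div_le_iff₀ hsk]
    linarith
  have hup : ∀ z ∈ A, z.1 ≤ (G l - M * Q l) / (-P l - Q l) := by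
    intro z hz
    have c1 := hz.2 l (Or.inr hl)
    have c2 := mul_nonneg (sub_nonneg.2 (hdiff z hz)) (neg_nonneg.2 hQl)
    rw [le_div_iff₀ hsl]
    linarith
  have hAc : IsCompact A := by
    refine Metric.isCompact_of_isClosed_isBounded hAcl ?_
    refine (((isCompact_Icc (a := -G k / (P k + Q k))
      (b := (G l - M * Q l) / (-P l - Q l))).prod
      (isCompact_Icc (a := -G k / (P k + Q k) - M)
      (b := (G l - M * Q l) / (-P l - Q l)))).isBounded).subset ?_
    intro z hz
    have h1 := hdiff z hz
    have h2 := hlow z hz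
    have h3 := hup z hz
    have h4 := hz.1
    exact ⟨⟨h2, h3⟩, by constructor <;> linarith⟩
  obtain ⟨⟨α, β⟩, hz, hmax⟩ := hAc.exists_isMaxOn (f := fun z : ℝ × ℝ => z.1 - z.2) hAne
    (by fun_prop)
  have hz1 : 0 ≤ α - β := hz.1
  have hz2 : ∀ u ∈ K ∪ L, 0 ≤ G u + α * P u + β * Q u := hz.2
  have hmax' : ∀ z ∈ A, z.1 - z.2 ≤ α - β := fun z hz => hmax hz
  have hH : Continuous fun u => G u + α * P u + β * Q u := by fun_prop
  refine ⟨α, β, hz2, ?_, ?_⟩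
  · by_contra! hno
    obtain ⟨m, hm, hmin⟩ := hK.exists_isMinOn ⟨k, hk⟩ hH.continuousOn
    obtain ⟨w, -, hwmax⟩ := hK.exists_isMaxOn ⟨k, hk⟩ hQ.continuousOn
    have hε : 0 < G m + α * P m + β * Q m := lt_of_le_of_ne (hz2 m (Or.inl hm)) (hno m hm).symm
    set ε := G m + α * P m + β * Q m with hεdef
    have hB : 0 ≤ Q w := hQk.trans (hwmax hk)
    have hs : 0 < ε / (Q w + 1) := by positivity
    have hsB : ε / (Q w + 1) * (Q w + 1) = ε := div_mul_cancel₀ _ (by positivity)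
    have := hmax' (α, β - ε / (Q w + 1)) ⟨by simp only; linarith, fun u hu => by
      simp only
      rcases hu with hu | hu
      · have h1 : ε ≤ G u + α * P u + β * Q u := hmin hu
        have h2 := mul_le_mul_of_nonneg_left (show Q u ≤ Q w from hwmax hu) hs.le
        linarith
      · have h1 := hz2 u (Or.inr hu)
        have h2 := mul_nonneg hs.le (neg_nonneg.2 (hQL u hu))
        linarith⟩
    simp only at this
    linarith
  · by_contra! hno
    obtain ⟨m, hm, hmin⟩ := hL.exists_isMinOn ⟨l, hl⟩ hH.continuousOn
    obtain ⟨w, -, hwmin⟩ := hL.exists_isMinOn ⟨l, hl⟩ hP.continuousOn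
    have hε : 0 < G m + α * P m + β * Q m := lt_of_le_of_ne (hz2 m (Or.inr hm)) (hno m hm).symm
    set ε := G m + α * P m + β * Q m with hεdef
    have hB : P w ≤ 0 := (show P w ≤ P l from hwmin hl).trans hPl
    have hB' : 0 < 1 - P w := by linarith
    have hs : 0 < ε / (1 - P w) := by positivity
    have hsB : ε / (1 - P w) * (1 - P w) = ε := div_mul_cancel₀ _ hB'.ne'
    have := hmax' (α + ε / (1 - P w), β) ⟨by simp only; linarith, fun u hu => by
      simp only
      rcases hu with hu | hu
      · have h1 := hz2 u (Or.inl hu)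
        have h2 := mul_nonneg hs.le (hPK u hu)
        linarith
      · have h1 : ε ≤ G u + α * P u + β * Q u := hmin hu
        have h2 := mul_le_mul_of_nonneg_left (show P w ≤ P u from hwmin hu) hs.le
        linarith⟩
    simp only at this
    linarith

lemma exists_saturated {K L : Set ℝ} (hK : IsCompact K) (hL : IsCompact L)
    {G P Q : ℝ → ℝ} (hG : Continuous G) (hP : Continuous P) (hQ : Continuous Q)
    (hGK : ∀ u ∈ K, 0 ≤ G u) (hGL : ∀ u ∈ L, 0 ≤ G u)
    (hPK : ∀ u ∈ K, 0 ≤ P u) (hQK : ∀ u ∈ K, 0 ≤ Q u)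
    (hPL : ∀ u ∈ L, P u ≤ 0) (hQL : ∀ u ∈ L, Q u ≤ 0)
    {k l : ℝ} (hk : k ∈ K) (hl : l ∈ L) (hne : P k * Q l ≠ P l * Q k) :
    ∃ α β : ℝ, (∀ u ∈ K ∪ L, 0 ≤ G u + α * P u + β * Q u) ∧
      (∃ u ∈ K, G u + α * P u + β * Q u = 0) ∧ ∃ u ∈ L, G u + α * P u + β * Q u = 0 := by
  rcases lt_or_gt_of_ne hne.symm with h | h
  · exact exists_saturated_of_lt hK hL hG hP hQ hGK hGL hPK hQK hPL hQL hk hl h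
  · obtain ⟨β, α, h1, ⟨u, hu, h2⟩, v, hv, h3⟩ := exists_saturated_of_lt hK hL hG hQ hP hGK hGL
      hQK hPK hQL hPL hk hl (by linarith)
    exact ⟨α, β, fun u hu => by linarith [h1 u hu], ⟨u, hu, by linarith⟩, v, hv, by linarith⟩

namespace AcausalMeridian

variable (Γ : AcausalMeridian)

/-! ### Support planes crossing a geodesic -/

/-- The unit normals of the spacelike support planes of `CH(Γ)` that contain neither endpoint of
the geodesic `γ` with endpoints `Γ.point t₁` and `Γ.point t₂`, and touch `Γ` in both open arcs
cut out by these endpoints. -/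
def crossingSupport (t₁ t₂ : ℝ) : Set V :=
  {n | form n n = -1 ∧ (∀ u, 0 ≤ form n (Γ.lift u)) ∧
    0 < form n (Γ.lift t₁) ∧ 0 < form n (Γ.lift t₂) ∧
    (∃ p ∈ Ioo t₁ t₂, form n (Γ.lift p) = 0) ∧
    ∃ q ∈ Ioo t₂ (t₁ + Real.pi), form n (Γ.lift q) = 0}

/-- The ratio of the values of a normal at the two endpoints of the geodesic.  It determines the
point where the plane meets the line through these endpoints, outside of `AdS³`. -/
noncomputable def endpointRatio (t₁ t₂ : ℝ) (n : V) : ℝ := form n (Γ.lift t₁) / form n (Γ.lift t₂)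

lemma form_hull_nonneg {n : V} (h : ∀ u, 0 ≤ form n (Γ.lift u)) : ∀ y ∈ Γ.hull, 0 ≤ form n y := by
  intro y hy
  have hconv : Convex ℝ {y : V | 0 ≤ form n y} := by
    intro x hx y hy a b ha hb _
    simp only [mem_ofPred_eq, form_add_right, form_smul_right] at *
    positivity
  exact convexHull_min (s := range Γ.lift) (by rintro _ ⟨u, rfl⟩; exact h u) hconv hy

/-- The plane touches the convex hull at the midpoint of two contact points, which lies in
`AdS³`. -/
lemma mem_futureSupport_union_pastSupport {t₁ t₂ : ℝ} {n : V}
    (hn : n ∈ Γ.crossingSupport t₁ t₂) : n ∈ Γ.futureSupport ∪ Γ.pastSupport := by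
  obtain ⟨hnn, hpos, -, -, ⟨p, hp, hnp⟩, q, hq, hnq⟩ := hn
  have hneg : form n n < 0 := by linarith
  have hpq := Γ.form_lift_neg_of_contact hneg (hp.2.trans hq.1) (by linarith [hp.1, hq.2]) hnp hnq
  set x : V := (1 / 2 : ℝ) • Γ.lift p + (1 / 2 : ℝ) • Γ.lift q with hx
  have hxh : x ∈ Γ.hull := (convex_convexHull ℝ (range Γ.lift))
    (subset_convexHull ℝ _ (mem_range_self p)) (subset_convexHull ℝ _ (mem_range_self q))
    (by norm_num) (by norm_num) (by norm_num)
  have hxx : form x x < 0 := by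
    simp only [hx, form_add_left, form_add_right, form_smul_left, form_smul_right, form_lift_self,
      form_comm (Γ.lift q) (Γ.lift p)]
    linarith
  have hnx : form n x = 0 := by
    simp only [hx, form_add_right, form_smul_right, hnp, hnq]; ring
  rcases lt_or_gt_of_ne (timeOrientation_ne_zero hxx hneg hnx) with h | h
  · exact Or.inr ⟨hnn, Γ.form_hull_nonneg hpos, x, hxh, hxx, hnx, h⟩
  · exact Or.inl ⟨hnn, Γ.form_hull_nonneg hpos, x, hxh, hxx, hnx, h⟩

lemma sin_sub_pos_of_not_onCommonLightlikeLine {t₁ t₂ : ℝ} (h₁ : t₁ < t₂)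
    (h₂ : t₂ < t₁ + Real.pi) (hγ : ¬ OnCommonLightlikeLine (Γ.point t₁) (Γ.point t₂)) :
    0 < Real.sin (Γ.left t₂ - Γ.left t₁) ∧ 0 < Real.sin (Γ.right t₂ - Γ.right t₁) := by
  constructor
  · refine lt_of_le_of_ne (Real.sin_nonneg_of_mem_Icc (Γ.left_sub_mem h₁.le h₂.le)) ?_
    intro h
    exact hγ (Or.inl (coe_eq_coe_of_sin_eq_zero h.symm).symm)
  · refine lt_of_le_of_ne (Real.sin_nonneg_of_mem_Icc (Γ.right_sub_mem h₁.le h₂.le)) ?_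
    intro h
    exact hγ (Or.inr (coe_eq_coe_of_sin_eq_zero h.symm).symm)

/-- If `Γ` does not bound a plane, every positive real number is the endpoint ratio of a support
plane crossing the geodesic.  In the basis given by the endpoints `a`, `b` of the geodesic and the
two points `e`, `f` that lie on lightlike lines through both, a normal with prescribed
values at `a` and `b` is determined by two coefficients `α`, `β`, and the plane is obtained from
the extremal problem of `exists_saturated`. -/
lemma exists_mem_crossingSupport (hΓ : ¬ Γ.BoundsPlane) {t₁ t₂ : ℝ} (h₁ : t₁ < t₂)
    (h₂ : t₂ < t₁ + Real.pi) (hγ : ¬ OnCommonLightlikeLine (Γ.point t₁) (Γ.point t₂))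
    {κ : ℝ} (hκ : 0 < κ) : ∃ n ∈ Γ.crossingSupport t₁ t₂, Γ.endpointRatio t₁ t₂ n = κ := by
  obtain ⟨hsl, hsr⟩ := Γ.sin_sub_pos_of_not_onCommonLightlikeLine h₁ h₂ hγ
  set a := Γ.lift t₁ with ha
  set b := Γ.lift t₂ with hb
  set e := nullVector (Γ.left t₁) (Γ.right t₂) with he
  set f := nullVector (Γ.left t₂) (Γ.right t₁) with hf
  set g := 2 * Real.sin (Γ.left t₂ - Γ.left t₁) * Real.sin (Γ.right t₂ - Γ.right t₁) with hg
  have hg0 : 0 < g := by positivity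
  have hab : form a b = -g := by
    rw [form_comm, ha, hb, lift, lift, form_nullVector, hg]; ring
  have hef : form e f = g := by
    rw [he, hf, form_nullVector, ← neg_sub (Γ.left t₂), Real.sin_neg, hg]; ring
  have haa : form a a = 0 := Γ.form_lift_self t₁
  have hbb : form b b = 0 := Γ.form_lift_self t₂
  have hee : form e e = 0 := form_nullVector_self _ _
  have hff : form f f = 0 := form_nullVector_self _ _
  have hae : form a e = 0 := by rw [ha, he, lift, form_nullVector]; simp
  have haf : form a f = 0 := by rw [ha, hf, lift, form_nullVector]; simp
  have hbe : form b e = 0 := by rw [hb, he, lift, form_nullVector]; simp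
  have hbf : form b f = 0 := by rw [hb, hf, lift, form_nullVector]; simp
  have hcont : ∀ w : V, Continuous fun u => form w (Γ.lift u) := fun w =>
    continuous_form.comp (continuous_const.prodMk Γ.continuous_lift)
  -- signs of the products with `e` and `f` on the two arcs
  have hP1 : ∀ u ∈ Icc t₁ t₂, 0 ≤ form f (Γ.lift u) := by
    intro u hu
    have s1 := Real.sin_nonneg_of_mem_Icc (Γ.left_sub_mem hu.2 (by linarith [hu.1]))
    have s2 := Real.sin_nonneg_of_mem_Icc (Γ.right_sub_mem hu.1 (by linarith [hu.2]))
    rw [hf, lift, form_nullVector, ← neg_sub (Γ.right u), Real.sin_neg]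
    linarith [mul_nonneg s1 s2]
  have hQ1 : ∀ u ∈ Icc t₁ t₂, 0 ≤ form e (Γ.lift u) := by
    intro u hu
    have s1 := Real.sin_nonneg_of_mem_Icc (Γ.left_sub_mem hu.1 (by linarith [hu.2]))
    have s2 := Real.sin_nonneg_of_mem_Icc (Γ.right_sub_mem hu.2 (by linarith [hu.1]))
    rw [he, lift, form_nullVector, ← neg_sub (Γ.left u), Real.sin_neg]
    linarith [mul_nonneg s1 s2]
  have hP2 : ∀ u ∈ Icc t₂ (t₁ + Real.pi), form f (Γ.lift u) ≤ 0 := by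
    intro u hu
    have s1 := Real.sin_nonneg_of_mem_Icc (Γ.left_sub_mem hu.1 (by linarith [hu.2]))
    have s2 := Real.sin_nonneg_of_mem_Icc (Γ.right_sub_mem (h₁.le.trans hu.1) hu.2)
    rw [hf, lift, form_nullVector, ← neg_sub (Γ.left u), ← neg_sub (Γ.right u), Real.sin_neg,
      Real.sin_neg]
    linarith [mul_nonneg s1 s2]
  have hQ2 : ∀ u ∈ Icc t₂ (t₁ + Real.pi), form e (Γ.lift u) ≤ 0 := by
    intro u hu
    have s1 := Real.sin_nonneg_of_mem_Icc (Γ.left_sub_mem (h₁.le.trans hu.1) hu.2)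
    have s2 := Real.sin_nonneg_of_mem_Icc (Γ.right_sub_mem hu.1 (by linarith [hu.2]))
    rw [he, lift, form_nullVector, ← neg_sub (Γ.left u), ← neg_sub (Γ.right u), Real.sin_neg,
      Real.sin_neg]
    linarith [mul_nonneg s1 s2]
  -- the products with `e` and `f` vanish simultaneously only at the endpoints
  have hnz : ∀ u, Γ.point u ≠ Γ.point t₁ → Γ.point u ≠ Γ.point t₂ →
      form f (Γ.lift u) = 0 → form e (Γ.lift u) = 0 → False := by
    intro u hu1 hu2 hfu heu
    rw [form_comm, hf, lift, form_nullVector] at hfu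
    rw [form_comm, he, lift, form_nullVector] at heu
    have hL : ¬ (Real.sin (Γ.left u - Γ.left t₁) = 0 ∧ Real.sin (Γ.left u - Γ.left t₂) = 0) := by
      rintro ⟨x, y⟩
      rw [show Γ.left t₂ - Γ.left t₁ = (Γ.left u - Γ.left t₁) - (Γ.left u - Γ.left t₂) by ring,
        Real.sin_sub, x, y] at hsl
      simp at hsl
    have hR : ¬ (Real.sin (Γ.right u - Γ.right t₁) = 0 ∧
        Real.sin (Γ.right u - Γ.right t₂) = 0) := by
      rintro ⟨x, y⟩
      rw [show Γ.right t₂ - Γ.right t₁ = (Γ.right u - Γ.right t₁) - (Γ.right u - Γ.right t₂)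
        by ring, Real.sin_sub, x, y] at hsr
      simp at hsr
    simp only [mul_eq_zero, neg_eq_zero, OfNat.ofNat_ne_zero, false_or] at hfu heu
    rcases hfu with x | x <;> rcases heu with y | y
    · exact hL ⟨y, x⟩
    · exact hu2 (bpoint_eq_of_sin_eq_zero x y)
    · exact hu1 (bpoint_eq_of_sin_eq_zero y x)
    · exact hR ⟨x, y⟩
  have hnz1 : ∀ u ∈ Ioo t₁ t₂, form f (Γ.lift u) = 0 → form e (Γ.lift u) = 0 → False :=
    fun u hu => hnz u (Γ.point_ne_of_lt hu.1 (by linarith [hu.2])).symm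
      (Γ.point_ne_of_lt hu.2 (by linarith [hu.1]))
  have hnz2 : ∀ u ∈ Ioo t₂ (t₁ + Real.pi),
      form f (Γ.lift u) = 0 → form e (Γ.lift u) = 0 → False :=
    fun u hu => hnz u (Γ.point_ne_of_lt (h₁.trans hu.1) hu.2).symm
      (Γ.point_ne_of_lt hu.1 (by linarith [hu.2])).symm
  have hcover : ∀ w : V, (∀ u ∈ Icc t₁ t₂ ∪ Icc t₂ (t₁ + Real.pi), 0 ≤ form w (Γ.lift u)) →
      ∀ u, 0 ≤ form w (Γ.lift u) := by
    intro w hw u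
    obtain ⟨v, hv, hvu, -⟩ := Γ.exists_shift_mem_Ico u t₁
    rw [← hvu]
    refine hw v ?_
    rcases le_total v t₂ with h | h
    · exact Or.inl ⟨hv.1, h⟩
    · exact Or.inr ⟨h, hv.2.le⟩
  -- otherwise `Γ` lies on a spacelike plane, or on the two lightlike lines through `e` or `f`
  have hcross : ∃ k ∈ Icc t₁ t₂, ∃ l ∈ Icc t₂ (t₁ + Real.pi),
      form f (Γ.lift k) * form e (Γ.lift l) ≠ form f (Γ.lift l) * form e (Γ.lift k) := by
    by_contra! hall
    have hm1 : (t₁ + t₂) / 2 ∈ Ioo t₁ t₂ := by constructor <;> linarith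
    have hm2 : (t₂ + (t₁ + Real.pi)) / 2 ∈ Ioo t₂ (t₁ + Real.pi) := by constructor <;> linarith
    have n1 := hnz1 _ hm1
    have n2 := hnz2 _ hm2
    have c1 := hall _ (Ioo_subset_Icc_self hm1)
    have c2 := fun k hk => hall k hk _ (Ioo_subset_Icc_self hm2)
    have c12 := c1 _ (Ioo_subset_Icc_self hm2)
    have p1 := hP1 _ (Ioo_subset_Icc_self hm1)
    have q1 := hQ1 _ (Ioo_subset_Icc_self hm1)
    generalize Γ.lift ((t₁ + t₂) / 2) = x at *
    generalize Γ.lift ((t₂ + (t₁ + Real.pi)) / 2) = y at *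
    have hzero : ∀ w : V, (∀ u ∈ Icc t₁ t₂, form w (Γ.lift u) = 0) →
        (∀ u ∈ Icc t₂ (t₁ + Real.pi), form w (Γ.lift u) = 0) → ∀ u, form w (Γ.lift u) = 0 := by
      intro w hw1 hw2 u
      have hw : ∀ u ∈ Icc t₁ t₂ ∪ Icc t₂ (t₁ + Real.pi), form w (Γ.lift u) = 0 := by
        rintro u (hu | hu)
        exacts [hw1 u hu, hw2 u hu]
      have i1 := hcover w (fun u hu => (hw u hu).ge) u
      have i2 := hcover ((-1 : ℝ) • w) (fun u hu => by rw [form_smul_left, hw u hu]; simp) u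
      rw [form_smul_left] at i2
      linarith
    have hfx : form f x ≠ 0 := by
      intro h0
      have hex : form e x ≠ 0 := n1 h0
      have hl : ∀ u ∈ Icc t₂ (t₁ + Real.pi), form f (Γ.lift u) = 0 := fun u hu => by
        have := c1 u hu
        rw [h0, zero_mul] at this
        exact (mul_eq_zero.1 this.symm).resolve_right hex
      have hfy : form f y = 0 := by
        rw [h0, zero_mul] at c12
        exact (mul_eq_zero.1 c12.symm).resolve_right hex
      have hk : ∀ u ∈ Icc t₁ t₂, form f (Γ.lift u) = 0 := fun u hu => by
        have := c2 u hu
        rw [hfy, zero_mul] at this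
        exact (mul_eq_zero.1 this).resolve_right (n2 hfy)
      obtain ⟨u, hu⟩ := Γ.exists_sin_mul_sin_ne_zero (Γ.left t₂) (Γ.right t₁)
      have := hzero f hk hl u
      rw [form_comm, hf, lift, form_nullVector] at this
      exact hu (by linarith)
    have hex : form e x ≠ 0 := by
      intro h0
      have hl : ∀ u ∈ Icc t₂ (t₁ + Real.pi), form e (Γ.lift u) = 0 := fun u hu => by
        have := c1 u hu
        rw [h0, mul_zero] at this
        exact (mul_eq_zero.1 this).resolve_left hfx
      have hey : form e y = 0 := by
        rw [h0, mul_zero] at c12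
        exact (mul_eq_zero.1 c12).resolve_left hfx
      have hk : ∀ u ∈ Icc t₁ t₂, form e (Γ.lift u) = 0 := fun u hu => by
        have := c2 u hu
        rw [hey, mul_zero] at this
        exact (mul_eq_zero.1 this.symm).resolve_left (fun h => n2 h hey)
      obtain ⟨u, hu⟩ := Γ.exists_sin_mul_sin_ne_zero (Γ.left t₁) (Γ.right t₂)
      have := hzero e hk hl u
      rw [form_comm, he, lift, form_nullVector] at this
      exact hu (by linarith)
    have hfx0 : 0 < form f x := lt_of_le_of_ne p1 hfx.symm
    have hex0 : 0 < form e x := lt_of_le_of_ne q1 hex.symm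
    have hey : form e y ≠ 0 := by
      intro h0
      rw [h0, mul_zero] at c12
      exact n2 ((mul_eq_zero.1 c12.symm).resolve_right hex) h0
    refine hΓ (Γ.boundsPlane_of_forall (n := form f x • e - form e x • f) ?_ (hzero _ ?_ ?_))
    · simp only [form_sub_left, form_sub_right, form_smul_left, form_smul_right, hee, hff, hef,
        form_comm f e]
      linarith [mul_pos (mul_pos hfx0 hex0) hg0]
    · intro u hu
      have := c2 u hu
      rw [form_sub_left, form_smul_left, form_smul_left]
      have h3 : (form f x * form e (Γ.lift u) - form e x * form f (Γ.lift u)) * form e y = 0 := by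
        linear_combination form e (Γ.lift u) * c12 - form e x * this
      exact (mul_eq_zero.1 h3).resolve_right hey
    · intro u hu
      have := c1 u hu
      rw [form_sub_left, form_smul_left, form_smul_left]
      linarith
  obtain ⟨k, hk, l, hl, hkl⟩ := hcross
  have hGpos : ∀ u ∈ Icc t₁ t₂ ∪ Icc t₂ (t₁ + Real.pi),
      0 ≤ form ((-κ) • b - a) (Γ.lift u) := by
    intro u hu
    have i1 : form a (Γ.lift u) ≤ 0 := by
      rw [form_comm]
      rcases hu with hu | hu
      · exact Γ.form_lift_nonpos hu.1 (by linarith [hu.2])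
      · exact Γ.form_lift_nonpos (h₁.le.trans hu.1) hu.2
    have i2 : form b (Γ.lift u) ≤ 0 := by
      rcases hu with hu | hu
      · exact Γ.form_lift_nonpos hu.2 (by linarith [hu.1])
      · rw [form_comm]
        exact Γ.form_lift_nonpos hu.1 (by linarith [hu.2])
    rw [form_sub_left, form_smul_left]
    linarith [mul_nonneg hκ.le (neg_nonneg.2 i2)]
  obtain ⟨α, β, hpos, ⟨p, hp, hp0⟩, q, hq, hq0⟩ := exists_saturated isCompact_Icc isCompact_Icc
    (hcont ((-κ) • b - a)) (hcont f) (hcont e) (fun u hu => hGpos u (Or.inl hu))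
    (fun u hu => hGpos u (Or.inr hu)) hP1 hQ1 hP2 hQ2 hk hl hkl
  set ν : V := (-κ) • b - a + α • f + β • e with hν
  have hνu : ∀ u, form ν (Γ.lift u)
      = form ((-κ) • b - a) (Γ.lift u) + α * form f (Γ.lift u) + β * form e (Γ.lift u) := by
    intro u
    rw [hν, form_add_left, form_add_left, form_smul_left, form_smul_left]
  have hνa : form ν a = κ * g := by
    simp only [hν, form_add_left, form_sub_left, form_smul_left, form_comm b a, form_comm f a,
      form_comm e a, hab, haa, hae, haf]
    ring
  have hνb : form ν b = g := by
    simp only [hν, form_add_left, form_sub_left, form_smul_left, form_comm f b,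
      form_comm e b, hab, hbb, hbe, hbf]
    ring
  have hνa0 : 0 < form ν a := by rw [hνa]; positivity
  have hνb0 : 0 < form ν b := by rw [hνb]; positivity
  have hνp : form ν (Γ.lift p) = 0 := by rw [hνu, hp0]
  have hνq : form ν (Γ.lift q) = 0 := by rw [hνu, hq0]
  have hp' : p ∈ Ioo t₁ t₂ := by
    refine ⟨lt_of_le_of_ne hp.1 ?_, lt_of_le_of_ne hp.2 ?_⟩ <;> rintro rfl
    · exact hνa0.ne' hνp
    · exact hνb0.ne' hνp
  have hq' : q ∈ Ioo t₂ (t₁ + Real.pi) := by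
    refine ⟨lt_of_le_of_ne hq.1 ?_, lt_of_le_of_ne hq.2 ?_⟩ <;> rintro rfl
    · exact hνb0.ne' hνq
    · rw [lift_add_pi] at hνq
      exact hνa0.ne' hνq
  -- saturation in both arcs forces the plane to be spacelike
  have hαβ : α * β < κ := by
    by_contra! hle
    have hprod : 0 < α * β := hκ.trans_le hle
    have gp := hGpos p (Or.inl hp)
    have gq := hGpos q (Or.inr hq)
    rcases (mul_pos_iff.1 hprod) with ⟨hα, hβ⟩ | ⟨hα, hβ⟩
    · have i1 := mul_nonneg hα.le (hP1 p hp)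
      have i2 := mul_nonneg hβ.le (hQ1 p hp)
      exact hnz1 p hp' ((mul_eq_zero.1 (by linarith : α * form f (Γ.lift p) = 0)).resolve_left
        hα.ne') ((mul_eq_zero.1 (by linarith : β * form e (Γ.lift p) = 0)).resolve_left hβ.ne')
    · have i1 := mul_nonneg_of_nonpos_of_nonpos hα.le (hP2 q hq)
      have i2 := mul_nonneg_of_nonpos_of_nonpos hβ.le (hQ2 q hq)
      exact hnz2 q hq' ((mul_eq_zero.1 (by linarith : α * form f (Γ.lift q) = 0)).resolve_left
        hα.ne) ((mul_eq_zero.1 (by linarith : β * form e (Γ.lift q) = 0)).resolve_left hβ.ne)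
  have hνν : form ν ν = 2 * g * (α * β - κ) := by
    simp only [hν, form_add_left, form_sub_left, form_smul_left, form_add_right, form_sub_right,
      form_smul_right, form_comm b a, form_comm f a, form_comm e a, form_comm f b, form_comm e b,
      form_comm f e, hab, haa, hbb, hee, hff, hae, haf, hbe, hbf, hef]
    ring
  have hννneg : 0 < -form ν ν := by
    rw [hνν]; nlinarith
  have hc : 0 < (√(-form ν ν))⁻¹ := by positivity
  refine ⟨(√(-form ν ν))⁻¹ • ν, ⟨?_, ?_, ?_, ?_, ⟨p, hp', ?_⟩, q, hq', ?_⟩, ?_⟩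
  · rw [form_smul_left, form_smul_right, ← mul_assoc, ← mul_inv, Real.mul_self_sqrt hννneg.le]
    have hne := (neg_pos.1 hννneg).ne
    field_simp
  · intro u
    rw [form_smul_left]
    exact mul_nonneg hc.le (hcover ν (fun u hu => by rw [hνu]; exact hpos u hu) u)
  · rw [form_smul_left]; exact mul_pos hc hνa0
  · rw [form_smul_left]; exact mul_pos hc hνb0
  · rw [form_smul_left, hνp, mul_zero]
  · rw [form_smul_left, hνq, mul_zero]
  · rw [endpointRatio, form_smul_left, form_smul_left, mul_div_mul_left _ _ hc.ne', ← ha, ← hb,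
      hνa, hνb]
    field_simp

end AcausalMeridian

open Filter Topology

/-! ### Limits of support planes -/

lemma _root_.IsCompact.exists_tendsto_ultrafilter {X ι : Type*} [TopologicalSpace X] {K : Set X}
    (hK : IsCompact K) (𝒰 : Ultrafilter ι) {x : ι → X} (hx : ∀ i, x i ∈ K) :
    ∃ x₀ ∈ K, Tendsto x 𝒰 (𝓝 x₀) :=
  hK.ultrafilter_le_nhds (𝒰.map x) (le_principal_iff.2 (Filter.mem_map.2 (univ_mem' hx)))

/-- Limits of directions between unit normals converging to `n₀` are tangent at `n₀` to the
hyperboloid of unit normals. -/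
lemma exists_limit_direction {ι : Type*} (𝒰 : Ultrafilter ι) {n m : ι → V} {n₀ : V}
    (hn : Tendsto n 𝒰 (𝓝 n₀)) (hm : Tendsto m 𝒰 (𝓝 n₀)) (hnn : ∀ i, form (n i) (n i) = -1)
    (hmm : ∀ i, form (m i) (m i) = -1) (hne : ∀ i, n i ≠ m i) :
    ∃ d : V, d ≠ 0 ∧ Tendsto (fun i => ‖n i - m i‖⁻¹ • (n i - m i)) 𝒰 (𝓝 d) ∧
      form d n₀ = 0 := by
  obtain ⟨d, hd, hlim⟩ := (isCompact_sphere (0 : V) 1).exists_tendsto_ultrafilter 𝒰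
    (x := fun i => ‖n i - m i‖⁻¹ • (n i - m i)) (fun i => by
      have : ‖n i - m i‖ ≠ 0 := norm_ne_zero_iff.2 (sub_ne_zero.2 (hne i))
      simp [norm_smul, this])
  refine ⟨d, ?_, hlim, ?_⟩
  · rintro rfl; simp at hd
  · have h1 : Tendsto (fun i => form (‖n i - m i‖⁻¹ • (n i - m i)) (n i + m i)) 𝒰
        (𝓝 (form d (n₀ + n₀))) := tendsto_form hlim (hn.add hm)
    have h2 : (fun i => form (‖n i - m i‖⁻¹ • (n i - m i)) (n i + m i)) = fun _ => 0 := by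
      funext i
      rw [form_smul_left, form_sub_left, form_add_right, form_add_right, hnn, hmm,
        form_comm (m i) (n i)]
      ring
    rw [h2] at h1
    have := tendsto_nhds_unique h1 tendsto_const_nhds
    rw [form_add_right] at this
    linarith

namespace AcausalMeridian

variable (Γ : AcausalMeridian)

lemma form_limit_lift_eq_zero {ι : Type*} {𝒰 : Ultrafilter ι} {n : ι → V} {n₀ : V} {x : ι → ℝ}
    {x₀ : ℝ} (hn : Tendsto n 𝒰 (𝓝 n₀)) (hx : Tendsto x 𝒰 (𝓝 x₀))
    (h : ∀ i, form (n i) (Γ.lift (x i)) = 0) : form n₀ (Γ.lift x₀) = 0 := by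
  have h1 : Tendsto (fun i => form (n i) (Γ.lift (x i))) 𝒰 (𝓝 (form n₀ (Γ.lift x₀))) :=
    tendsto_form hn ((Γ.continuous_lift.tendsto x₀).comp hx)
  simp only [h] at h1
  exact (tendsto_nhds_unique h1 tendsto_const_nhds)

/-- Contact points of two families of support planes that converge to the same point force the
limit direction to vanish there: the difference of the normals has one sign at the contact
points of the first family and the opposite sign at those of the second. -/
lemma form_limit_direction_eq_zero {ι : Type*} {𝒰 : Ultrafilter ι} {n m : ι → V} {d : V}
    {x y : ι → ℝ} {x₀ : ℝ}
    (hd : Tendsto (fun i => ‖n i - m i‖⁻¹ • (n i - m i)) 𝒰 (𝓝 d))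
    (hx : Tendsto x 𝒰 (𝓝 x₀)) (hy : Tendsto y 𝒰 (𝓝 x₀))
    (hnx : ∀ i, form (n i) (Γ.lift (x i)) = 0) (hmx : ∀ i, 0 ≤ form (m i) (Γ.lift (x i)))
    (hmy : ∀ i, form (m i) (Γ.lift (y i)) = 0) (hny : ∀ i, 0 ≤ form (n i) (Γ.lift (y i))) :
    form d (Γ.lift x₀) = 0 := by
  have lim : ∀ z : ι → ℝ, Tendsto z 𝒰 (𝓝 x₀) →
      Tendsto (fun i => form (‖n i - m i‖⁻¹ • (n i - m i)) (Γ.lift (z i))) 𝒰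
        (𝓝 (form d (Γ.lift x₀))) := fun z hz =>
    tendsto_form hd ((Γ.continuous_lift.tendsto x₀).comp hz)
  refine le_antisymm (le_of_tendsto' (lim x hx) fun i => ?_) (ge_of_tendsto' (lim y hy) fun i => ?_)
  · rw [form_smul_left, form_sub_left, hnx, zero_sub]
    have := hmx i
    have : 0 ≤ ‖n i - m i‖⁻¹ := by positivity
    nlinarith
  · rw [form_smul_left, form_sub_left, hmy, sub_zero]
    exact mul_nonneg (by positivity) (hny i)

/-- The support planes crossing the geodesic and touching `Γ` at exactly two points. -/
def geodesicSupport (t₁ t₂ : ℝ) : Set V :=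
  {n ∈ Γ.crossingSupport t₁ t₂ | ∃ p ∈ Ioo t₁ t₂, ∃ q ∈ Ioo t₂ (t₁ + Real.pi),
    form n (Γ.lift p) = 0 ∧ form n (Γ.lift q) = 0 ∧
    ∀ u ∈ Ico t₁ (t₁ + Real.pi), form n (Γ.lift u) = 0 → u = p ∨ u = q}

/-- The support planes crossing the geodesic and having three contact points separated by the
intervals `(r₁, r₂)` and `(r₃, r₄)`. -/
def polygonSupport (t₁ t₂ r₁ r₂ r₃ r₄ : ℝ) : Set V :=
  {n ∈ Γ.crossingSupport t₁ t₂ | ∃ x ∈ Icc t₁ r₁, ∃ y ∈ Icc r₂ r₃, ∃ z ∈ Icc r₄ (t₁ + Real.pi),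
    form n (Γ.lift x) = 0 ∧ form n (Γ.lift y) = 0 ∧ form n (Γ.lift z) = 0}

lemma crossingSupport_subset (t₁ t₂ : ℝ) :
    Γ.crossingSupport t₁ t₂ ⊆ Γ.geodesicSupport t₁ t₂ ∪
      ⋃ r ∈ {r : ℚ × ℚ × ℚ × ℚ | r.1 < r.2.1 ∧ r.2.2.1 < r.2.2.2},
        Γ.polygonSupport t₁ t₂ r.1 r.2.1 r.2.2.1 r.2.2.2 := by
  intro n hn
  obtain ⟨p, hp, hnp⟩ := hn.2.2.2.2.1
  obtain ⟨q, hq, hnq⟩ := hn.2.2.2.2.2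
  have three : ∀ x y z : ℝ, t₁ ≤ x → x < y → y < z → z ≤ t₁ + Real.pi →
      form n (Γ.lift x) = 0 → form n (Γ.lift y) = 0 → form n (Γ.lift z) = 0 →
      n ∈ ⋃ r ∈ {r : ℚ × ℚ × ℚ × ℚ | r.1 < r.2.1 ∧ r.2.2.1 < r.2.2.2},
        Γ.polygonSupport t₁ t₂ r.1 r.2.1 r.2.2.1 r.2.2.2 := by
    intro x y z hx hxy hyz hz h1 h2 h3
    obtain ⟨r₁, h11, h12⟩ := exists_rat_btwn hxy
    obtain ⟨r₂, h21, h22⟩ := exists_rat_btwn h12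
    obtain ⟨r₃, h31, h32⟩ := exists_rat_btwn hyz
    obtain ⟨r₄, h41, h42⟩ := exists_rat_btwn h32
    refine mem_biUnion (x := (r₁, r₂, r₃, r₄)) ⟨?_, ?_⟩ ⟨hn, x, ⟨hx, h11.le⟩, y,
      ⟨h22.le, h31.le⟩, z, ⟨h42.le, hz⟩, h1, h2, h3⟩
    · exact_mod_cast h21
    · exact_mod_cast h41
  by_cases h : ∀ u ∈ Ico t₁ (t₁ + Real.pi), form n (Γ.lift u) = 0 → u = p ∨ u = q
  · exact Or.inl ⟨hn, p, hp, q, hq, hnp, hnq, h⟩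
  · push Not at h
    obtain ⟨u, hu, hnu, hup, huq⟩ := h
    right
    rcases lt_or_gt_of_ne hup with h1 | h1
    · exact three u p q hu.1 h1 (hp.2.trans hq.1) hq.2.le hnu hnp hnq
    rcases lt_or_gt_of_ne huq with h2 | h2
    · exact three p u q hp.1.le h1 h2 hq.2.le hnp hnu hnq
    · exact three p q u hp.1.le (hp.2.trans hq.1) h2 hu.2.le hnp hnq hnu

/-- Support planes with three separated contact points are isolated: a limit direction would be
orthogonal to three independent isotropic vectors and to the normal itself. -/
lemma eventually_eq_of_mem_polygonSupport {t₁ t₂ r₁ r₂ r₃ r₄ : ℝ} (h12 : r₁ < r₂) (h34 : r₃ < r₄)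
    {n₀ : V} (h₀ : n₀ ∈ Γ.polygonSupport t₁ t₂ r₁ r₂ r₃ r₄) :
    ∀ᶠ n in 𝓝 n₀, n ∈ Γ.polygonSupport t₁ t₂ r₁ r₂ r₃ r₄ → n = n₀ := by
  by_contra hcon
  rw [not_eventually] at hcon
  obtain ⟨n, hlim, hn⟩ := exists_seq_forall_of_frequently hcon
  push Not at hn
  have hn1 := fun i => (hn i).1
  have hneg : form n₀ n₀ < 0 := by rw [h₀.1.1]; norm_num
  set 𝒰 : Ultrafilter ℕ := hyperfilter ℕ
  have hlim' : Tendsto n 𝒰 (𝓝 n₀) := hlim.mono_left Nat.hyperfilter_le_atTop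
  obtain ⟨d, hd0, hd, hdn⟩ := exists_limit_direction 𝒰 hlim' (m := fun _ => n₀)
    tendsto_const_nhds (fun i => (hn1 i).1.1) (fun _ => h₀.1.1) (fun i => (hn i).2)
  choose x hx y hy z hz h1 h2 h3 using fun i => (hn1 i).2
  obtain ⟨x₀, hx₀, hx'⟩ := isCompact_Icc.exists_tendsto_ultrafilter 𝒰 hx
  obtain ⟨y₀, hy₀, hy'⟩ := isCompact_Icc.exists_tendsto_ultrafilter 𝒰 hy
  obtain ⟨z₀, hz₀, hz'⟩ := isCompact_Icc.exists_tendsto_ultrafilter 𝒰 hz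
  have hnx := Γ.form_limit_lift_eq_zero hlim' hx' h1
  have hny := Γ.form_limit_lift_eq_zero hlim' hy' h2
  have hnz := Γ.form_limit_lift_eq_zero hlim' hz' h3
  have hz₁ : z₀ < t₁ + Real.pi := by
    refine lt_of_le_of_ne hz₀.2 ?_
    rintro rfl
    rw [lift_add_pi] at hnz
    exact h₀.1.2.2.1.ne' hnz
  have hxy : x₀ < y₀ := by linarith [hx₀.2, hy₀.1]
  have hyz : y₀ < z₀ := by linarith [hy₀.2, hz₀.1]
  have hx1 := hx₀.1
  have lim : ∀ (w : ℕ → ℝ) (w₀ : ℝ), Tendsto w 𝒰 (𝓝 w₀) → form n₀ (Γ.lift w₀) = 0 →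
      (∀ i, form (n i) (Γ.lift (w i)) = 0) → form d (Γ.lift w₀) = 0 := fun w w₀ hw hw₀ hw' =>
    Γ.form_limit_direction_eq_zero hd hw (tendsto_const_nhds (x := w₀)) hw'
      (fun i => h₀.1.2.1 _) (fun _ => hw₀) (fun i => (hn1 i).1.2.1 _)
  exact hd0 (eq_zero_of_form_eq_zero hneg (Γ.form_lift_self x₀) (Γ.form_lift_self y₀)
    (Γ.form_lift_self z₀) hnx hny hnz
    (Γ.form_lift_neg_of_contact hneg hxy (by linarith) hnx hny).ne
    (Γ.form_lift_neg_of_contact hneg (hxy.trans hyz) (by linarith) hnx hnz).ne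
    (Γ.form_lift_neg_of_contact hneg hyz (by linarith) hny hnz).ne
    hdn (lim x x₀ hx' hnx h1) (lim y y₀ hy' hny h2) (lim z z₀ hz' hnz h3))

/-- Near a support plane with exactly two contact points, the Lorentzian separation of crossing
support planes is comparable to the Euclidean distance of their normals: a limit direction is
orthogonal to the normal and to both contact points, hence spacelike. -/
lemma exists_norm_sq_le_form {t₁ t₂ : ℝ} {n₀ : V}
    (h₀ : n₀ ∈ Γ.geodesicSupport t₁ t₂) :
    ∃ c > 0, ∀ᶠ z in 𝓝 (n₀, n₀), z.1 ∈ Γ.crossingSupport t₁ t₂ → z.2 ∈ Γ.crossingSupport t₁ t₂ →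
      c * ‖z.1 - z.2‖ ^ 2 ≤ form (z.1 - z.2) (z.1 - z.2) := by
  by_contra! hcon
  have hseq : ∀ k : ℕ, ∃ z : V × V, dist z (n₀, n₀) < 1 / ((k : ℝ) + 1) ∧
      z.1 ∈ Γ.crossingSupport t₁ t₂ ∧ z.2 ∈ Γ.crossingSupport t₁ t₂ ∧
      form (z.1 - z.2) (z.1 - z.2) < 1 / ((k : ℝ) + 1) * ‖z.1 - z.2‖ ^ 2 := by
    intro k
    have hk : (0 : ℝ) < 1 / ((k : ℝ) + 1) := by positivity
    obtain ⟨z, hz, hz'⟩ := ((hcon _ hk).and_eventually (Metric.ball_mem_nhds _ hk)).exists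
    exact ⟨z, hz', hz⟩
  choose w hdist hw1 hw2 hsmall using hseq
  set 𝒰 : Ultrafilter ℕ := hyperfilter ℕ
  have hk0 : Tendsto (fun k : ℕ => 1 / ((k : ℝ) + 1)) 𝒰 (𝓝 0) :=
    tendsto_one_div_add_atTop_nhds_zero_nat.mono_left Nat.hyperfilter_le_atTop
  have hlim : Tendsto w 𝒰 (𝓝 (n₀, n₀)) := by
    rw [tendsto_iff_dist_tendsto_zero]
    exact squeeze_zero (fun _ => dist_nonneg) (fun k => (hdist k).le) hk0
  have hlim1 : Tendsto (fun k => (w k).1) 𝒰 (𝓝 n₀) := (continuous_fst.tendsto _).comp hlim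
  have hlim2 : Tendsto (fun k => (w k).2) 𝒰 (𝓝 n₀) := (continuous_snd.tendsto _).comp hlim
  have hne : ∀ k, (w k).1 ≠ (w k).2 := by
    intro k h
    have := hsmall k
    rw [h, sub_self] at this
    simp [form] at this
  obtain ⟨d, hd0, hd, hdn⟩ := exists_limit_direction 𝒰 hlim1 hlim2 (fun i => (hw1 i).1)
    (fun i => (hw2 i).1) hne
  obtain ⟨hcr, p, hp, q, hq, hnp, hnq, huniq⟩ := h₀
  have hneg : form n₀ n₀ < 0 := by rw [hcr.1]; norm_num
  choose x hx hx1 using fun i => (hw1 i).2.2.2.2.1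
  choose x' hx' hx1' using fun i => (hw2 i).2.2.2.2.1
  choose y hy hy1 using fun i => (hw1 i).2.2.2.2.2
  choose y' hy' hy1' using fun i => (hw2 i).2.2.2.2.2
  -- contact points of the two families converge to those of the limit plane
  have toP : ∀ (n : ℕ → V) (v : ℕ → ℝ), Tendsto n 𝒰 (𝓝 n₀) → (∀ i, v i ∈ Ioo t₁ t₂) →
      (∀ i, form (n i) (Γ.lift (v i)) = 0) → Tendsto v 𝒰 (𝓝 p) := by
    intro n v hn hv h0
    obtain ⟨v₀, hv₀, hv'⟩ := isCompact_Icc.exists_tendsto_ultrafilter 𝒰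
      (fun i => Ioo_subset_Icc_self (hv i))
    have hz := Γ.form_limit_lift_eq_zero hn hv' h0
    rcases huniq v₀ ⟨hv₀.1, by linarith [hv₀.2, hq.1, hq.2]⟩ hz with rfl | rfl
    · exact hv'
    · linarith [hv₀.2, hq.1]
  have toQ : ∀ (n : ℕ → V) (v : ℕ → ℝ), Tendsto n 𝒰 (𝓝 n₀) →
      (∀ i, v i ∈ Ioo t₂ (t₁ + Real.pi)) →
      (∀ i, form (n i) (Γ.lift (v i)) = 0) → Tendsto v 𝒰 (𝓝 q) := by
    intro n v hn hv h0
    obtain ⟨v₀, hv₀, hv'⟩ := isCompact_Icc.exists_tendsto_ultrafilter 𝒰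
      (fun i => Ioo_subset_Icc_self (hv i))
    have hz := Γ.form_limit_lift_eq_zero hn hv' h0
    have hlt : v₀ < t₁ + Real.pi := by
      refine lt_of_le_of_ne hv₀.2 ?_
      rintro rfl
      rw [lift_add_pi] at hz
      exact hcr.2.2.1.ne' hz
    rcases huniq v₀ ⟨by linarith [hv₀.1, hp.1, hp.2], hlt⟩ hz with rfl | rfl
    · linarith [hv₀.1, hp.2]
    · exact hv'
  have hdp : form d (Γ.lift p) = 0 := Γ.form_limit_direction_eq_zero hd
    (toP _ x hlim1 hx hx1) (toP _ x' hlim2 hx' hx1') hx1 (fun i => (hw2 i).2.1 _) hx1'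
    (fun i => (hw1 i).2.1 _)
  have hdq : form d (Γ.lift q) = 0 := Γ.form_limit_direction_eq_zero hd
    (toQ _ y hlim1 hy hy1) (toQ _ y' hlim2 hy' hy1') hy1 (fun i => (hw2 i).2.1 _) hy1'
    (fun i => (hw1 i).2.1 _)
  have hpq := Γ.form_lift_neg_of_contact hneg (hp.2.trans hq.1) (by linarith [hp.1, hq.2]) hnp hnq
  have hpos : 0 < form d d := by
    refine form_self_pos_of_orthogonal (x := Γ.lift p + Γ.lift q) hneg ?_ ?_ hdn ?_ hd0
    · simp only [form_add_left, form_add_right, form_lift_self, form_comm (Γ.lift q)]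
      linarith
    · rw [form_add_right, hnp, hnq, add_zero]
    · rw [form_add_right, hdp, hdq, add_zero]
  have hle : form d d ≤ 0 := by
    have h1 : Tendsto (fun k => form (‖(w k).1 - (w k).2‖⁻¹ • ((w k).1 - (w k).2))
        (‖(w k).1 - (w k).2‖⁻¹ • ((w k).1 - (w k).2))) 𝒰 (𝓝 (form d d)) := tendsto_form hd hd
    refine le_of_tendsto_of_tendsto' h1 hk0 fun k => ?_
    have hnorm : 0 < ‖(w k).1 - (w k).2‖ := norm_pos_iff.2 (sub_ne_zero.2 (hne k))
    rw [form_smul_left, form_smul_right, ← mul_assoc, ← mul_inv, ← sq,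
      inv_mul_le_iff₀ (by positivity)]
    linarith [hsmall k]
  linarith

end AcausalMeridian

/-! ### Lower bounds for the bending measure -/

/-- A real function that is Lipschitz with respect to the angle on `A` gives a lower bound for
the length of `A`. -/
lemma volume_image_le_bendingLength {D : Set V} {A : Set D} {f : V → ℝ} {C : ℝ≥0∞} (hC0 : C ≠ 0)
    (hC : C ≠ ∞) (h : ∀ n ∈ A, ∀ m ∈ A, edist (f n) (f m) ≤ C * ENNReal.ofReal (angle n m)) :
    volume ((fun n : D => f n) '' A) ≤ C * bendingLength D A := by
  set μ : OuterMeasure D := C⁻¹ • OuterMeasure.restrict A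
    (OuterMeasure.comap (fun n : D => f n) (volume : Measure ℝ).toOuterMeasure) with hμ
  have hμA : ∀ S : Set D, μ S = C⁻¹ * volume ((fun n : D => f n) '' (S ∩ A)) := by
    intro S
    simp [hμ]
  have hle : μ ≤ OuterMeasure.mkMetric'
      (fun S : Set D => ⨆ n ∈ S, ⨆ m ∈ S, ENNReal.ofReal (angle n m)) := by
    refine le_trans ?_ (le_iSup₂_of_le (1 : ℝ≥0∞) one_pos le_rfl)
    rw [OuterMeasure.mkMetric'.le_pre]
    intro S _
    rw [hμA, ENNReal.inv_mul_le_iff hC0 hC]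
    refine (Real.volume_le_diam _).trans (Metric.ediam_le ?_)
    rintro _ ⟨n, hn, rfl⟩ _ ⟨m, hm, rfl⟩
    refine (h n hn.2 m hm.2).trans (mul_le_mul_right ?_ C)
    exact le_iSup₂_of_le n hn.1 (le_iSup₂_of_le m hm.1 le_rfl)
  have h1 : μ A ≤ bendingLength D A := (hle A).trans (le_toMeasure_apply _
    (OuterMeasure.mkMetric'_isMetric _).le_caratheodory _)
  rwa [hμA, inter_self, ENNReal.inv_mul_le_iff hC0 hC] at h1

/-- The angle between two nearby planes is at least a multiple of the Lorentzian length of the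
difference of their unit normals. -/
lemma sqrt_form_sub_le_angle {n m : V} (hn : form n n = -1) (hm : form m m = -1)
    (h0 : 0 ≤ form (n - m) (n - m)) (h1 : form (n - m) (n - m) ≤ 1) :
    √(form (n - m) (n - m)) ≤ 4 * angle n m := by
  set q := form (n - m) (n - m) with hq
  have hnm : -form n m = 1 + q / 2 := by
    have : q = form n n - 2 * form n m + form m m := by
      rw [hq, form_sub_left, form_sub_right, form_sub_right, form_comm m n]; ring
    rw [hn, hm] at this
    linarith
  rw [angle, hnm, Real.arcosh]
  set r := √((1 + q / 2) ^ 2 - 1) with hr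
  have hsq : √q ≤ r := Real.sqrt_le_sqrt (by nlinarith)
  have hr2 : r ≤ 2 := Real.sqrt_le_iff.2 ⟨by norm_num, by nlinarith⟩
  have hr0 : 0 ≤ r := Real.sqrt_nonneg _
  have hlog := Real.one_sub_inv_le_log_of_pos (show 0 < 1 + q / 2 + r by linarith)
  have hy : 1 + q / 2 + r ≤ 4 := by linarith
  have hfrac : r / 4 ≤ 1 - (1 + q / 2 + r)⁻¹ := by
    rw [show 1 - (1 + q / 2 + r)⁻¹ = (q / 2 + r) / (1 + q / 2 + r) by field_simp; ring]
    rw [div_le_div_iff₀ (by norm_num) (by linarith)]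
    nlinarith
  linarith

namespace AcausalMeridian

variable (Γ : AcausalMeridian)

lemma exists_lipschitzOn_endpointRatio {t₁ t₂ : ℝ} {n₀ : V} (h₀ : form n₀ (Γ.lift t₂) ≠ 0) :
    ∃ K, ∃ U ∈ 𝓝 n₀, LipschitzOnWith K (Γ.endpointRatio t₁ t₂) U := by
  have : ContDiffAt ℝ 1 (Γ.endpointRatio t₁ t₂) n₀ :=
    (contDiff_form_left _).contDiffAt.div (contDiff_form_left _).contDiffAt h₀
  exact this.exists_lipschitzOnWith

/-- Near a support plane with exactly two contact points, the endpoint ratio is Lipschitz with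
respect to the angle. -/
lemma exists_edist_endpointRatio_le_angle {t₁ t₂ : ℝ} {n₀ : V}
    (h₀ : n₀ ∈ Γ.geodesicSupport t₁ t₂) :
    ∃ C : ℝ≥0∞, C ≠ 0 ∧ C ≠ ∞ ∧ ∃ U ∈ 𝓝 n₀, ∀ n ∈ U ∩ Γ.geodesicSupport t₁ t₂,
      ∀ m ∈ U ∩ Γ.geodesicSupport t₁ t₂,
      edist (Γ.endpointRatio t₁ t₂ n) (Γ.endpointRatio t₁ t₂ m)
        ≤ C * ENNReal.ofReal (angle n m) := by
  obtain ⟨K, U₁, hU₁, hK⟩ :=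
    Γ.exists_lipschitzOn_endpointRatio (t₁ := t₁) (t₂ := t₂) h₀.1.2.2.2.1.ne'
  obtain ⟨c, hc, hev⟩ := Γ.exists_norm_sq_le_form h₀
  have hsub : Tendsto (fun z : V × V => z.1 - z.2) (𝓝 (n₀, n₀)) (𝓝 0) :=
    (continuous_fst.sub continuous_snd).tendsto' _ _ (sub_self n₀)
  have hsmall : ∀ᶠ z : V × V in 𝓝 (n₀, n₀), form (z.1 - z.2) (z.1 - z.2) < 1 := by
    have h := tendsto_form hsub hsub
    exact h.eventually_lt_const (by simp [form])
  have hall := hev.and hsmall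
  rw [nhds_prod_eq] at hall
  obtain ⟨U₂, hU₂, hall⟩ := Filter.eventually_prod_self_iff'.1 hall
  set B : ℝ := (K + 1) * (4 / √c) with hB
  have hB0 : 0 < B := by positivity
  refine ⟨ENNReal.ofReal B, by simpa using hB0, ENNReal.ofReal_ne_top, U₁ ∩ U₂,
    inter_mem hU₁ hU₂, ?_⟩
  rintro n ⟨⟨hn1, hn2⟩, hn⟩ m ⟨⟨hm1, hm2⟩, hm⟩
  obtain ⟨hlow, hq1⟩ := hall n hn2 m hm2
  have hlow' := hlow hn.1 hm.1
  simp only at hlow' hq1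
  have hq0 : 0 ≤ form (n - m) (n - m) := le_trans (by positivity) hlow'
  have hang := sqrt_form_sub_le_angle hn.1.1 hm.1.1 hq0 hq1.le
  have hnorm : √c * ‖n - m‖ ≤ √(form (n - m) (n - m)) := by
    refine Real.le_sqrt_of_sq_le ?_
    rwa [mul_pow, Real.sq_sqrt hc.le]
  have hsc : 0 < √c := Real.sqrt_pos.2 hc
  have hdist : dist n m ≤ 4 / √c * angle n m := by
    rw [dist_eq_norm, div_mul_eq_mul_div, le_div_iff₀ hsc]
    linarith
  have hfd := hK.dist_le_mul n hn1 m hm1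
  rw [edist_dist, ← ENNReal.ofReal_mul hB0.le]
  refine ENNReal.ofReal_le_ofReal (hfd.trans ?_)
  rw [hB, mul_assoc]
  have hd0 : 0 ≤ dist n m := dist_nonneg
  calc (K : ℝ) * dist n m ≤ (K + 1) * dist n m := by linarith
    _ ≤ _ := mul_le_mul_of_nonneg_left hdist (by positivity)

/-- The support planes of `D` that cross the geodesic and have exactly two contact points are
among those along the leaves crossing it. -/
lemma mem_planesAlong_of_mem_geodesicSupport {D : Set V} {t₁ t₂ : ℝ} (n : D)
    (hn : (n : V) ∈ Γ.geodesicSupport t₁ t₂) : n ∈ Γ.planesAlong D (Γ.crossing t₁ t₂) := by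
  obtain ⟨-, p, hp, q, hq, hnp, hnq, huniq⟩ := hn
  refine ⟨Γ.point p, Γ.point q, Γ.point_ne_of_lt (hp.2.trans hq.1) (by linarith [hp.1, hq.2]), ?_,
    Γ.point p, ⟨p, hp, rfl⟩, Γ.point q, ⟨q, hq, rfl⟩, rfl⟩
  ext x
  constructor
  · rintro ⟨u, rfl, hu⟩
    obtain ⟨v, hv, hvl, hvp⟩ := Γ.exists_shift_mem_Ico u t₁
    rw [← hvp]
    rw [← hvl] at hu
    rcases huniq v hv hu with rfl | rfl
    · exact Or.inl rfl
    · exact Or.inr rfl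
  · rintro (rfl | rfl)
    · exact ⟨p, rfl, hnp⟩
    · exact ⟨q, rfl, hnq⟩

/-- If the intersection number vanishes, the endpoint ratios of the support planes crossing the
geodesic with exactly two contact points form a null set. -/
lemma volume_image_geodesicSupport_eq_zero {D : Set V} {t₁ t₂ : ℝ}
    (h : Γ.intersectionNumber (Γ.bendingLamination D) t₁ t₂ = 0) :
    volume (Γ.endpointRatio t₁ t₂ '' (Γ.geodesicSupport t₁ t₂ ∩ D)) = 0 := by
  have hzero : bendingLength D (Γ.planesAlong D (Γ.crossing t₁ t₂)) = 0 := h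
  set ν := OuterMeasure.comap (Γ.endpointRatio t₁ t₂) (volume : Measure ℝ).toOuterMeasure with hν
  have hνS : ∀ S, ν S = volume (Γ.endpointRatio t₁ t₂ '' S) := fun S => by simp [hν]
  rw [← hνS]
  refine measure_null_of_locally_null _ fun n₀ hn₀ => ?_
  obtain ⟨C, hC0, hC, U, hU, hlip⟩ := Γ.exists_edist_endpointRatio_le_angle hn₀.1
  refine ⟨U ∩ (Γ.geodesicSupport t₁ t₂ ∩ D),
    inter_mem (mem_nhdsWithin_of_mem_nhds hU) self_mem_nhdsWithin, ?_⟩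
  rw [hνS]
  set A : Set D := {n | (n : V) ∈ U ∩ Γ.geodesicSupport t₁ t₂} with hA
  have himage : Γ.endpointRatio t₁ t₂ '' (U ∩ (Γ.geodesicSupport t₁ t₂ ∩ D)) ⊆
      (fun n : D => Γ.endpointRatio t₁ t₂ n) '' A := by
    rintro _ ⟨n, ⟨hnU, hnS, hnD⟩, rfl⟩
    exact ⟨⟨n, hnD⟩, ⟨hnU, hnS⟩, rfl⟩
  have hA0 : bendingLength D A = 0 := measure_mono_null
    (fun n hn => Γ.mem_planesAlong_of_mem_geodesicSupport n hn.2) hzero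
  refine measure_mono_null himage (le_antisymm ?_ zero_le)
  refine (volume_image_le_bendingLength (A := A) hC0 hC (fun n hn m hm => hlip n hn m hm)).trans ?_
  rw [hA0, mul_zero]

lemma volume_image_polygonSupport_eq_zero {t₁ t₂ r₁ r₂ r₃ r₄ : ℝ} (h12 : r₁ < r₂) (h34 : r₃ < r₄) :
    volume (Γ.endpointRatio t₁ t₂ '' Γ.polygonSupport t₁ t₂ r₁ r₂ r₃ r₄) = 0 := by
  set ν := OuterMeasure.comap (Γ.endpointRatio t₁ t₂) (volume : Measure ℝ).toOuterMeasure with hν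
  have hνS : ∀ S, ν S = volume (Γ.endpointRatio t₁ t₂ '' S) := fun S => by simp [hν]
  rw [← hνS]
  refine measure_null_of_locally_null _ fun n₀ hn₀ => ⟨{n₀}, ?_, ?_⟩
  · filter_upwards [mem_nhdsWithin_of_mem_nhds
      (Γ.eventually_eq_of_mem_polygonSupport h12 h34 hn₀), self_mem_nhdsWithin] with n hn hn'
    exact hn hn'
  · rw [hνS, image_singleton, Real.volume_singleton]

end AcausalMeridian

end AdS

/-! ### The bending laminations weakly fill -/

theorem mainTheorem4 (Γ : AdS.AcausalMeridian) (hΓ : ¬ Γ.BoundsPlane)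
    (t₁ t₂ : ℝ) (h₁ : t₁ < t₂) (h₂ : t₂ < t₁ + Real.pi)
    (hγ : ¬ AdS.OnCommonLightlikeLine (Γ.point t₁) (Γ.point t₂)) :
    0 < Γ.intersectionNumber Γ.futureBending t₁ t₂ +
      Γ.intersectionNumber Γ.pastBending t₁ t₂ := by
  rw [pos_iff_ne_zero]
  intro hsum
  obtain ⟨hf, hp⟩ := add_eq_zero.1 hsum
  have hF := Γ.volume_image_geodesicSupport_eq_zero hf
  have hP := Γ.volume_image_geodesicSupport_eq_zero hp
  have hT : volume (⋃ r ∈ {r : ℚ × ℚ × ℚ × ℚ | r.1 < r.2.1 ∧ r.2.2.1 < r.2.2.2},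
      Γ.endpointRatio t₁ t₂ '' Γ.polygonSupport t₁ t₂ r.1 r.2.1 r.2.2.1 r.2.2.2) = 0 := by
    refine (measure_biUnion_null_iff (to_countable _)).2 fun r hr => ?_
    exact Γ.volume_image_polygonSupport_eq_zero (by exact_mod_cast hr.1) (by exact_mod_cast hr.2)
  have hsub : Ioi (0 : ℝ) ⊆
      (Γ.endpointRatio t₁ t₂ '' (Γ.geodesicSupport t₁ t₂ ∩ Γ.futureSupport) ∪
        Γ.endpointRatio t₁ t₂ '' (Γ.geodesicSupport t₁ t₂ ∩ Γ.pastSupport)) ∪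
      ⋃ r ∈ {r : ℚ × ℚ × ℚ × ℚ | r.1 < r.2.1 ∧ r.2.2.1 < r.2.2.2},
        Γ.endpointRatio t₁ t₂ '' Γ.polygonSupport t₁ t₂ r.1 r.2.1 r.2.2.1 r.2.2.2 := by
    intro κ hκ
    obtain ⟨n, hn, rfl⟩ := Γ.exists_mem_crossingSupport hΓ h₁ h₂ hγ hκ
    rcases Γ.crossingSupport_subset t₁ t₂ hn with hS | hS
    · rcases Γ.mem_futureSupport_union_pastSupport hn with hD | hD
      · exact Or.inl (Or.inl ⟨n, ⟨hS, hD⟩, rfl⟩)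
      · exact Or.inl (Or.inr ⟨n, ⟨hS, hD⟩, rfl⟩)
    · obtain ⟨r, hr, hnr⟩ := mem_iUnion₂.1 hS
      exact Or.inr (mem_biUnion hr ⟨n, hnr, rfl⟩)
  have := measure_mono_null hsub (measure_union_null (measure_union_null hF hP) hT)
  rw [Real.volume_Ioi] at this
  exact ENNReal.top_ne_zero this
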